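/- Let $f:\mathbb R^n\to\mathbb R^n$ and $B:\mathbb R^n\to\mathbb R^{n\times n}$ be of class $C^2$, and let $\bar u(x-st)$ be a periodic traveling-wave solution of $u_t+f(u)_x=(B(u)u_x)_x$: that is, $s\in\mathbb R$, $\bar u\in C^2(\mathbb R;\mathbb R^n)$ is periodic with period $T>0$, and $(B(\bar u)\bar u')'=f(\bar u)'-s\bar u'$. Assume that every eigenvalue of $B(\bar u(x))$ has positive real part, for all $x$. In the rest frame of the wave write $B(x)=B(\bar u(x))$ and $A(x)v=df(\bar u(x))v-sv-(dB(\bar u(x))v)\,\bar u'(x)$, and let $$Lv=(Bv')'-(Av)'$$ be the linearized operator, acting on $L^p(\mathbb R;\mathbb C^n)$, $1\le p\le\infty$, with domain $W^{2,p}(\mathbb R;\mathbb C^n)$. Its spectrum $\sigma_{L^p}(L)$ is the set of $\lambda\in\mathbb C$ for which $L-\lambda$ has no bounded two-sided inverse on $L^p$. Let $$\mathbb A(\lambda,x)=\begin{pmatrix}0&I\\ B^{-1}(\lambda I+A')&B^{-1}(A-B')\end{pmatrix}$$ be the coefficient matrix of the first-order system for $W=(w,w')$ equivalent to $(Bw')'=(Aw)'+\lambda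 w$. Then for every $\lambda\in\mathbb C$ the problem $\Psi'=\mathbb A(\lambda,x)\Psi$, $\Psi(0,\lambda)=I$ has exactly one solution on $\mathbb R$. With the monodromy matrix $M(\lambda)=\Psi(T,\lambda)$ and the Evans function $D(k,\lambda)=\det(M(\lambda)-e^{ikT}I)$, the following hold. 1. For every $1\le p\le\infty$, $\sigma_{L^p}(L)$ is exactly the set of eigenvalues of $L$ on $L^\infty$. 2. $\lambda$ is an eigenvalue of $L$ on $L^\infty$ if and only if $\det(M(\lambda)-\gamma I)=0$ for some $\gamma\in\mathbb C$ with $|\gamma|=1$. 3. Consequently, for every $1\le p\le\infty$, $\sigma_{L^p}(L)=\{\lambda\in\mathbb C:\ D(k,\lambda)=0\text{ for some }k\in\mathbb R\}$. -/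

import Mathlib

open MeasureTheory
open scoped ENNReal ContDiff Matrix

noncomputable section

namespace PeriodicWave

/-! ### Closed operators and their spectrum -/

section Spectrum

variable {X : Type*} [NormedAddCommGroup X] [NormedSpace ℂ X]

/-- The resolvent set of an (unbounded) operator `L` on `X`: those `z` for which
`L - z`, as a map from the domain of `L` to `X`, has a bounded two-sided inverse. -/
def resolventSet (L : X →ₗ.[ℂ] X) : Set ℂ :=
  {z | ∃ R : X →L[ℂ] X,
    (∀ g : X, ∃ h : R g ∈ L.domain, L ⟨R g, h⟩ - z • R g = g) ∧
    ∀ v : L.domain, R (L v - z • (v : X)) = v}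

/-- The spectrum of an (unbounded) operator. -/
def spectrum (L : X →ₗ.[ℂ] X) : Set ℂ := (resolventSet L)ᶜ

/-- The set of eigenvalues of an (unbounded) operator. -/
def eigenvalues (L : X →ₗ.[ℂ] X) : Set ℂ :=
  {z | ∃ v : L.domain, (v : X) ≠ 0 ∧ L v = z • (v : X)}

end Spectrum

/-! ### Weak derivatives on the line -/

section Weak

variable {E : Type*} [NormedAddCommGroup E] [NormedSpace ℝ E]

/-- `g` is a weak derivative of `f` on `ℝ` (both locally integrable). -/
structure HasWeakDeriv (f g : ℝ → E) : Prop where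
  left : LocallyIntegrable f
  right : LocallyIntegrable g
  integral_eq : ∀ φ : ℝ → ℝ, ContDiff ℝ ∞ φ → HasCompactSupport φ →
    ∫ x, deriv φ x • f x = - ∫ x, φ x • g x

theorem HasWeakDeriv.congr {f g f' g' : ℝ → E} (h : HasWeakDeriv f g)
    (hf : f =ᵐ[volume] f') (hg : g =ᵐ[volume] g') : HasWeakDeriv f' g' where
  left := h.left.congr hf
  right := h.right.congr hg
  integral_eq φ hφ hc := by
    have h1 : ∫ x, deriv φ x • f' x = ∫ x, deriv φ x • f x :=
      integral_congr_ae (hf.mono fun x hx => by simp only [hx])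
    have h2 : ∫ x, φ x • g' x = ∫ x, φ x • g x :=
      integral_congr_ae (hg.mono fun x hx => by simp only [hx])
    rw [h1, h2, h.integral_eq φ hφ hc]

theorem HasWeakDeriv.zero : HasWeakDeriv (fun _ => (0 : E)) (fun _ => 0) where
  left := locallyIntegrable_zero
  right := locallyIntegrable_zero
  integral_eq φ _ _ := by simp

theorem HasWeakDeriv.add {f g f' g' : ℝ → E} (h : HasWeakDeriv f g) (h' : HasWeakDeriv f' g') :
    HasWeakDeriv (fun x => f x + f' x) (fun x => g x + g' x) where
  left := h.left.add h'.left
  right := h.right.add h'.right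
  integral_eq φ hφ hc := by
    have hd : Continuous (deriv φ) := hφ.continuous_deriv (by norm_num)
    have hdc : HasCompactSupport (deriv φ) := hc.deriv
    simp only [smul_add]
    rw [integral_add (h.left.integrable_smul_left_of_hasCompactSupport hd hdc)
        (h'.left.integrable_smul_left_of_hasCompactSupport hd hdc),
      integral_add (h.right.integrable_smul_left_of_hasCompactSupport hφ.continuous hc)
        (h'.right.integrable_smul_left_of_hasCompactSupport hφ.continuous hc),
      h.integral_eq φ hφ hc, h'.integral_eq φ hφ hc, neg_add]

theorem HasWeakDeriv.const_smul [NormedSpace ℂ E] [SMulCommClass ℝ ℂ E]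
    {f g : ℝ → E} (h : HasWeakDeriv f g) (c : ℂ) :
    HasWeakDeriv (fun x => c • f x) (fun x => c • g x) where
  left := h.left.smul c
  right := h.right.smul c
  integral_eq φ hφ hc := by
    simp only [smul_comm _ c]
    rw [integral_smul, integral_smul, h.integral_eq φ hφ hc, smul_neg]

theorem HasWeakDeriv.ae_eq_zero [CompleteSpace E] {f g : ℝ → E} (h : HasWeakDeriv f g)
    (hf : f =ᵐ[volume] fun _ => 0) : g =ᵐ[volume] fun _ => 0 := by
  refine ae_eq_zero_of_integral_contDiff_smul_eq_zero h.right fun φ hφ hc => ?_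
  have h1 := h.integral_eq φ hφ hc
  have h2 : ∫ x, deriv φ x • f x = 0 := by
    rw [← integral_zero ℝ E (μ := volume)]
    exact integral_congr_ae (hf.mono fun x hx => by simp only [hx, smul_zero])
  rw [h2] at h1
  exact neg_eq_zero.mp h1.symm

end Weak

/-! ### The operator `L v = (B v')' - (A v)'` on `L^p(ℝ; ℂⁿ)` -/

section Operator

variable {n : ℕ}

/-- The action of a matrix on `ℂⁿ` with its Euclidean norm. -/
abbrev act (M : Matrix (Fin n) (Fin n) ℂ) (v : EuclideanSpace ℂ (Fin n)) :
    EuclideanSpace ℂ (Fin n) := Matrix.toEuclideanCLM (𝕜 := ℂ) M v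

/-- The space `L^p(ℝ; ℂⁿ)`. -/
abbrev LpSpace (n : ℕ) (p : ℝ≥0∞) : Type :=
  Lp (EuclideanSpace ℂ (Fin n)) p (volume : Measure ℝ)

/-- `v` lies in the Sobolev space `W^{2,p}(ℝ; ℂⁿ)` (that is, `v`, `v₁ = v'` and `v₂ = v''` are in
`L^p`, derivatives being weak ones) and `(B v' - A v)' = g`. -/
def OpRel (A B : ℝ → Matrix (Fin n) (Fin n) ℂ) (p : ℝ≥0∞) (v g : LpSpace n p) : Prop :=
  ∃ v₁ v₂ : LpSpace n p, HasWeakDeriv v v₁ ∧ HasWeakDeriv v₁ v₂ ∧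
    HasWeakDeriv (fun x => act (B x) (v₁ x) - act (A x) (v x)) g

variable {A B : ℝ → Matrix (Fin n) (Fin n) ℂ} {p : ℝ≥0∞}

theorem OpRel.zero : OpRel A B p 0 0 := by
  have hz := (Lp.coeFn_zero (EuclideanSpace ℂ (Fin n)) p (volume : Measure ℝ)).symm
  refine ⟨0, 0, HasWeakDeriv.zero.congr hz hz, HasWeakDeriv.zero.congr hz hz,
    HasWeakDeriv.zero.congr ?_ hz⟩
  filter_upwards [hz] with x hx
  rw [← hx]
  simp

theorem OpRel.add {v g v' g' : LpSpace n p} (h : OpRel A B p v g) (h' : OpRel A B p v' g') :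
    OpRel A B p (v + v') (g + g') := by
  obtain ⟨v₁, v₂, h1, h2, h3⟩ := h
  obtain ⟨v₁', v₂', h1', h2', h3'⟩ := h'
  refine ⟨v₁ + v₁', v₂ + v₂', (h1.add h1').congr (Lp.coeFn_add _ _).symm
    (Lp.coeFn_add _ _).symm, (h2.add h2').congr (Lp.coeFn_add _ _).symm
    (Lp.coeFn_add _ _).symm, (h3.add h3').congr ?_ (Lp.coeFn_add _ _).symm⟩
  filter_upwards [Lp.coeFn_add v v', Lp.coeFn_add v₁ v₁'] with x hx hx1
  rw [hx, hx1, Pi.add_apply, Pi.add_apply, act, act, act, act, act, act, map_add, map_add]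
  abel

theorem OpRel.smul {v g : LpSpace n p} (c : ℂ) (h : OpRel A B p v g) :
    OpRel A B p (c • v) (c • g) := by
  obtain ⟨v₁, v₂, h1, h2, h3⟩ := h
  have hs : ∀ w : LpSpace n p, (fun x => c • w x) =ᵐ[volume] (c • w : LpSpace n p) := fun w =>
    (Lp.coeFn_smul c w).symm
  have h3' := (h3.const_smul c).congr (f' := fun x =>
    act (B x) ((c • v₁ : LpSpace n p) x) - act (A x) ((c • v : LpSpace n p) x)) (by
      filter_upwards [hs v, hs v₁] with x hx hx1
      rw [← hx, ← hx1, smul_sub]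
      exact congrArg₂ _ ((Matrix.toEuclideanCLM (𝕜 := ℂ) (B x)).map_smul c (v₁ x)).symm
        ((Matrix.toEuclideanCLM (𝕜 := ℂ) (A x)).map_smul c (v x)).symm) (hs g)
  exact ⟨c • v₁, c • v₂, (h1.const_smul c).congr (hs v) (hs v₁),
    (h2.const_smul c).congr (hs v₁) (hs v₂), h3'⟩

theorem OpRel.eq_zero {v g : LpSpace n p} (h : OpRel A B p v g) (h0 : v = 0) : g = 0 := by
  obtain ⟨v₁, v₂, h1, -, h3⟩ := h
  have hv : (v : ℝ → EuclideanSpace ℂ (Fin n)) =ᵐ[volume] fun _ => 0 := by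
    rw [h0]; exact Lp.coeFn_zero _ _ _
  have hv1 := h1.ae_eq_zero hv
  have hg := h3.ae_eq_zero (by
    filter_upwards [hv, hv1] with x hx hx1
    rw [hx, hx1, act, act, map_zero, map_zero, sub_zero])
  exact Lp.ext (hg.trans (Lp.coeFn_zero _ _ _).symm)

/-- The graph in `L^p × L^p` of `L v = (B v')' - (A v)'` on the domain `W^{2,p}`. -/
def opGraph (A B : ℝ → Matrix (Fin n) (Fin n) ℂ) (p : ℝ≥0∞) [Fact (1 ≤ p)] :
    Submodule ℂ (LpSpace n p × LpSpace n p) where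
  carrier := {w | OpRel A B p w.1 w.2}
  zero_mem' := OpRel.zero
  add_mem' h h' := OpRel.add h h'
  smul_mem' c _ h := OpRel.smul c h

/-- The operator `L v = (B v')' - (A v)'` on `L^p(ℝ; ℂⁿ)`: its domain consists of the `v` in
`W^{2,p}(ℝ; ℂⁿ)` for which the right-hand side is in `L^p` (all of `W^{2,p}` when `A`, `B` are
periodic of class `C¹`). -/
def op (A B : ℝ → Matrix (Fin n) (Fin n) ℂ) (p : ℝ≥0∞) [Fact (1 ≤ p)] :
    LpSpace n p →ₗ.[ℂ] LpSpace n p :=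
  (opGraph A B p).toLinearPMap

theorem mem_op_graph [Fact (1 ≤ p)] (v g : LpSpace n p) :
    (v, g) ∈ (op A B p).graph ↔ OpRel A B p v g := by
  rw [op, Submodule.toLinearPMap_graph_eq _ fun _ hx h0 => OpRel.eq_zero hx h0]
  rfl

end Operator

/-! ### First-order system, fundamental solution, monodromy matrix -/

section Monodromy

variable {n : ℕ} {ι : Type*} [Fintype ι] [DecidableEq ι]

/-- Entrywise derivative of a matrix-valued function. -/
def matDeriv (M : ℝ → Matrix ι ι ℂ) (x : ℝ) : Matrix ι ι ℂ :=
  Matrix.of fun i j => deriv (fun y => M y i j) x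

/-- The coefficient matrix of the first-order system for `W = (w, w')` equivalent to
`(B w')' = (A w)' + z w`. -/
def systemMatrix (A B : ℝ → Matrix (Fin n) (Fin n) ℂ) (z : ℂ) (x : ℝ) :
    Matrix (Fin n ⊕ Fin n) (Fin n ⊕ Fin n) ℂ :=
  Matrix.fromBlocks 0 1
    ((B x)⁻¹ * (z • (1 : Matrix (Fin n) (Fin n) ℂ) + matDeriv A x))
    ((B x)⁻¹ * (A x - matDeriv B x))

/-- `Ψ` solves `Ψ' = 𝔸 Ψ` on `ℝ`, `Ψ 0 = 1`. -/
def IsFundamentalSolution (𝔸 Ψ : ℝ → Matrix ι ι ℂ) : Prop :=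
  (∀ x i j, HasDerivAt (fun y => Ψ y i j) ((𝔸 x * Ψ x) i j) x) ∧ Ψ 0 = 1

open Classical in
/-- The fundamental solution of `W' = 𝔸 W` (the identity if there is none, which does not happen
for continuous coefficients). -/
def fundamentalSolution (𝔸 : ℝ → Matrix ι ι ℂ) : ℝ → Matrix ι ι ℂ :=
  if h : ∃ Ψ, IsFundamentalSolution 𝔸 Ψ then h.choose else 1

/-- The monodromy matrix `M(z) = Ψ(T, z)`. -/
def monodromy (A B : ℝ → Matrix (Fin n) (Fin n) ℂ) (T : ℝ) (z : ℂ) :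
    Matrix (Fin n ⊕ Fin n) (Fin n ⊕ Fin n) ℂ :=
  fundamentalSolution (systemMatrix A B z) T

/-- The periodic Evans function `D(k, z) = det (M(z) - e^{ikT})`. -/
def evans (A B : ℝ → Matrix (Fin n) (Fin n) ℂ) (T k : ℝ) (z : ℂ) : ℂ :=
  (monodromy A B T z - Complex.exp (Complex.I * k * T) •
    (1 : Matrix (Fin n ⊕ Fin n) (Fin n ⊕ Fin n) ℂ)).det

end Monodromy

/-! ### Linearization of `u_t + f(u)_x = (B(u) u_x)_x` about a profile `ubar(x - s t)` -/

section Linearization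

variable {n : ℕ}

/-- The diffusion coefficient `B(ubar(x))`, as a complex matrix. -/
def coeffB (B : (Fin n → ℝ) → Matrix (Fin n) (Fin n) ℝ) (ubar : ℝ → Fin n → ℝ) (x : ℝ) :
    Matrix (Fin n) (Fin n) ℂ :=
  (B (ubar x)).map Complex.ofReal

/-- The convection coefficient, `A(x) v = df(ubar(x)) v - s v - (dB(ubar(x)) v) ubar'(x)`,
as a complex matrix. -/
def coeffA (f : (Fin n → ℝ) → Fin n → ℝ) (B : (Fin n → ℝ) → Matrix (Fin n) (Fin n) ℝ)
    (ubar : ℝ → Fin n → ℝ) (s x : ℝ) : Matrix (Fin n) (Fin n) ℂ :=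
  (LinearMap.toMatrix' (fderiv ℝ f (ubar x) : (Fin n → ℝ) →ₗ[ℝ] (Fin n → ℝ))
    - s • (1 : Matrix (Fin n) (Fin n) ℝ)
    - Matrix.of fun i j =>
        ∑ k, fderiv ℝ (fun u => B u i k) (ubar x) (Pi.single j 1) * deriv ubar x k).map
    Complex.ofReal

end Linearization

end PeriodicWave

end

/-! The equation (L - z)v = g is the first-order system W' = 𝔸W + F for W = (v, v'), with F = (0,
B⁻¹g). Everything rests on comparing the line with the lattice of periods.

No multiplier on the unit circle. By variation of constants the values W(kT) satisfy W((k+1)T) = M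
W(kT) + H(k), where H(k) is the forcing accumulated over one period. So L^p solvability on the line
becomes invertibility of S - M on ℓ^p(ℤ), S being the shift. Since S and S⁻¹ are contractions, the
spectrum of S lies on the unit circle for every p. If P is the characteristic polynomial of M, then
P(M) = 0, and S - M divides P(S) - P(M) = P(S), which is a product of factors S - μ over the roots μ
of P. If no root has modulus one, P(S) is invertible, hence so is S - M
(`isUnit_shift_sub_pointwise`). The propagator is bounded over one period, so the ℓ^p solution
yields an L^p solution with a bound, and the same argument excludes homogeneous solutions
(`exists_solution_memLp`, `ae_eq_zero_of_memLp`). No Fourier transform enters, so p = 1 and p = ∞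
are not special.

A multiplier γ on the unit circle. An eigenvector of M gives a bounded Bloch solution w(x + T) = γ
w(x), which is an eigenfunction on L^∞. For general p, cut w off at scale l: (L - z)(ψw) contains
only derivatives of ψ, so it is O(1/l) on an interval of length 4l. A bounded left inverse of L - z
would give ‖ψw‖_p = O(l^(1/p - 1)), and by Hölder the integral of |w| over (0, l] would stay bounded
as l grows. But |w| is periodic and nonzero, so this integral grows linearly
(`not_mem_resolventSet_of_multiplier`).

Thus for every p the spectrum is the set of z having a multiplier of modulus one, a set independent
of p. The L^∞ eigenvalues lie between this set and the L^∞ spectrum, and writing γ = e^{ikT} gives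
the Evans function form. -/

noncomputable section

namespace PeriodicWave

/-! ### Calculus of weak derivatives on the line -/

section WeakCalculus

variable {E F : Type*} [NormedAddCommGroup E] [NormedSpace ℝ E] [NormedSpace ℂ E]
  [IsScalarTower ℝ ℂ E] [CompleteSpace E]
  [NormedAddCommGroup F] [NormedSpace ℝ F] [NormedSpace ℂ F] [IsScalarTower ℝ ℂ F] [CompleteSpace F]

omit [IsScalarTower ℝ ℂ E] in
/-- Integration by parts against a compactly supported `C¹` operator-valued function. -/
theorem integral_deriv_clm_primitive {g : ℝ → E} (hg : LocallyIntegrable g)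
    {θ : ℝ → E →L[ℂ] F} (hθ : ContDiff ℝ 1 θ) (hc : HasCompactSupport θ) (f₀ : E) :
    ∫ x, deriv θ x (f₀ + ∫ t in (0 : ℝ)..x, g t) = - ∫ x, θ x (g x) := by
  obtain ⟨R, hR0, hR⟩ : ∃ R : ℝ, 0 < R ∧ tsupport θ ⊆ Set.Ioc (-R) R := by
    obtain ⟨R, hR⟩ := hc.isBounded.subset_ball (0 : ℝ)
    refine ⟨max R 1, by positivity, fun x hx => ?_⟩
    have := hR hx
    rw [Metric.mem_ball, Real.dist_eq, sub_zero, abs_lt] at this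
    exact ⟨by linarith [le_max_left R 1], by linarith [le_max_left R 1]⟩
  have hd : Continuous (deriv θ) := hθ.continuous_deriv le_rfl
  have hdc : HasCompactSupport (deriv θ) := hc.deriv
  have hdi : Integrable (deriv θ) := hd.integrable_of_hasCompactSupport hdc
  have hd0 : ∀ x, x ∉ Set.Ioc (-R) R → deriv θ x = 0 := fun x hx =>
    image_eq_zero_of_notMem_tsupport fun h => hx (hR (tsupport_deriv_subset h))
  have hθ0 : ∀ x, x ∉ Set.Ioc (-R) R → θ x = 0 := fun x hx =>
    image_eq_zero_of_notMem_tsupport fun h => hx (hR h)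
  set gR : ℝ → E := (Set.Ioc (-R) R).indicator g with hgR
  have hgi : Integrable gR := by
    rw [hgR, integrable_indicator_iff measurableSet_Ioc]
    exact (hg.integrableOn_isCompact isCompact_Icc).mono_set Set.Ioc_subset_Icc_self
  have hII : ∀ a b, IntervalIntegrable g volume a b := fun a b =>
    (hg.integrableOn_isCompact isCompact_uIcc).intervalIntegrable
  set c : E := f₀ + ∫ t in (0 : ℝ)..(-R), g t
  -- Moving the base point of the primitive from 0 to -R, left of the support of θ, makes the inner
  -- integral run over t < x; Fubini then applies to an integrable function on the plane.
  have key : ∀ x, deriv θ x (f₀ + ∫ t in (0 : ℝ)..x, g t) =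
      deriv θ x c + ∫ t, (Set.Ioi t).indicator (fun y => deriv θ y (gR t)) x := by
    intro x
    by_cases hx : x ∈ Set.Ioc (-R) R
    · have h1 : (∫ t in (0 : ℝ)..x, g t) = (∫ t in (0 : ℝ)..(-R), g t) + ∫ t in (-R)..x, g t :=
        (intervalIntegral.integral_add_adjacent_intervals (hII _ _) (hII _ _)).symm
      have h2 : (∫ t in (-R)..x, g t) = ∫ t, (Set.Iio x).indicator gR t := by
        rw [intervalIntegral.integral_of_le hx.1.le, integral_Ioc_eq_integral_Ioo,
          ← integral_indicator measurableSet_Ioo]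
        congr 1
        ext t
        simp only [hgR, Set.indicator_apply, Set.mem_Ioo, Set.mem_Ioc, Set.mem_Iio]
        have := hx.2
        split_ifs <;> first | rfl | (exfalso; grind)
      have h3 : Integrable ((Set.Iio x).indicator gR) := hgi.indicator measurableSet_Iio
      rw [h1, ← add_assoc, map_add, h2, ← ContinuousLinearMap.integral_comp_comm _ h3]
      congr 2
      ext t
      simp only [Set.indicator_apply, Set.mem_Iio, Set.mem_Ioi]
      split_ifs <;> simp
    · have : ∀ t, (Set.Ioi t).indicator (fun y => deriv θ y (gR t)) x = 0 := by
        intro t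
        simp [Set.indicator_apply, hd0 x hx]
      simp only [this, integral_zero, add_zero, hd0 x hx, zero_apply]
  simp only [key]
  have hprod : Integrable (Function.uncurry fun x t =>
      (Set.Ioi t).indicator (fun y => deriv θ y (gR t)) x) (volume.prod volume) := by
    have h1 : Integrable (fun z : ℝ × ℝ => ‖deriv θ z.1‖ * ‖gR z.2‖) (volume.prod volume) :=
      hdi.norm.mul_prod hgi.norm
    have h2 : AEStronglyMeasurable (fun z : ℝ × ℝ => deriv θ z.1 (gR z.2))
        (volume.prod volume) := by
      have ha : AEStronglyMeasurable (fun z : ℝ × ℝ => deriv θ z.1) (volume.prod volume) :=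
        (hd.comp continuous_fst).aestronglyMeasurable
      have hb : AEStronglyMeasurable (fun z : ℝ × ℝ => gR z.2) (volume.prod volume) :=
        hgi.aestronglyMeasurable.comp_snd
      exact isBoundedBilinearMap_apply.continuous.comp_aestronglyMeasurable (ha.prodMk hb)
    have h3 : Integrable (fun z : ℝ × ℝ => deriv θ z.1 (gR z.2)) (volume.prod volume) :=
      h1.mono' h2 (Filter.Eventually.of_forall fun z => (deriv θ z.1).le_opNorm _)
    have h4 := h3.indicator (s := {z : ℝ × ℝ | z.2 < z.1})
      (measurableSet_lt measurable_snd measurable_fst)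
    refine h4.congr (Filter.Eventually.of_forall fun z => ?_)
    simp only [Function.uncurry, Set.indicator_apply, Set.mem_ofPred_eq, Set.mem_Ioi]
  have hi1 : Integrable fun x => deriv θ x c :=
    hdi.apply_continuousLinearMap c
  have hi2 : Integrable fun x => ∫ t, (Set.Ioi t).indicator (fun y => deriv θ y (gR t)) x :=
    hprod.integral_prod_left
  -- The constant of integration drops out because θ has compact support.
  have hz : ∫ x, deriv θ x c = 0 := by
    rw [← ContinuousLinearMap.integral_apply hdi c]
    have : ∫ x, deriv θ x = 0 :=
      integral_eq_zero_of_hasDerivAt_of_integrable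
        (fun x => (hθ.differentiable one_ne_zero x).hasDerivAt) hdi
        (hθ.continuous.integrable_of_hasCompactSupport hc)
    rw [this]; rfl
  rw [integral_add hi1 hi2, hz, zero_add, integral_integral_swap hprod, ← integral_neg]
  refine integral_congr_ae (Filter.Eventually.of_forall fun t => ?_)
  simp only
  rw [integral_indicator measurableSet_Ioi,
    ← ContinuousLinearMap.integral_apply hdi.integrableOn (gR t),
    hc.integral_Ioi_deriv_eq hθ]
  by_cases ht : t ∈ Set.Ioc (-R) R
  · simp [hgR, ht]
  · simp [hθ0 t ht]

omit [NormedSpace ℂ E] [IsScalarTower ℝ ℂ E] [CompleteSpace E] in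
theorem continuous_primitive_of_locallyIntegrable {g : ℝ → E} (hg : LocallyIntegrable g) :
    Continuous fun x => ∫ t in (0 : ℝ)..x, g t :=
  intervalIntegral.continuous_primitive (fun _ _ =>
    (hg.integrableOn_isCompact isCompact_uIcc).intervalIntegrable) 0

theorem hasWeakDeriv_primitive {g : ℝ → E} (hg : LocallyIntegrable g) (f₀ : E) :
    HasWeakDeriv (fun x => f₀ + ∫ t in (0 : ℝ)..x, g t) g where
  left := (continuous_const.add (continuous_primitive_of_locallyIntegrable hg)).locallyIntegrable
  right := hg
  integral_eq φ hφ hc := by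
    have hφ1 : ContDiff ℝ 1 φ := hφ.of_le (by norm_num)
    have h := integral_deriv_clm_primitive (F := E) hg
      (θ := fun x => φ x • ContinuousLinearMap.id ℂ E) (hφ1.smul contDiff_const)
      hc.smul_right f₀
    have hd : ∀ x, deriv (fun x => φ x • ContinuousLinearMap.id ℂ E) x =
        deriv φ x • ContinuousLinearMap.id ℂ E := fun x =>
      (HasDerivAt.smul_const (f := ContinuousLinearMap.id ℂ E)
        (hφ1.differentiable one_ne_zero x).hasDerivAt).deriv
    simpa [hd] using h

omit [NormedSpace ℂ E] [IsScalarTower ℝ ℂ E] in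
/-- A function with zero weak derivative is constant. -/
theorem HasWeakDeriv.ae_eq_const {f : ℝ → E} (h : HasWeakDeriv f fun _ => 0) :
    ∃ c : E, f =ᵐ[volume] fun _ => c := by
  let ρ : ContDiffBump (0 : ℝ) := ⟨1, 2, one_pos, one_lt_two⟩
  let r : ℝ → ℝ := ρ.normed volume
  have hr : ContDiff ℝ ∞ r := ρ.contDiff_normed
  have hrc : HasCompactSupport r := ρ.hasCompactSupport_normed
  have hr1 : ∫ x, r x = 1 := ρ.integral_normed
  refine ⟨∫ x, r x • f x, ?_⟩
  have hz : (fun x => f x - ∫ x, r x • f x) =ᵐ[volume] fun _ => 0 := by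
    refine ae_eq_zero_of_integral_contDiff_smul_eq_zero
      (h.left.sub (locallyIntegrable_const _)) fun ψ hψ hψc => ?_
    set m : ℝ := ∫ x, ψ x with hm
    -- Subtracting a multiple of the unit-mass bump makes the mean zero, so the primitive φ of η
    -- again has compact support and is an admissible test function.
    let η : ℝ → ℝ := fun x => ψ x - m * r x
    have hη : ContDiff ℝ ∞ η := hψ.sub (contDiff_const.mul hr)
    have hηc : HasCompactSupport η := hψc.sub hrc.mul_left
    have hψi : Integrable ψ := hψ.continuous.integrable_of_hasCompactSupport hψc
    have hri : Integrable r := hr.continuous.integrable_of_hasCompactSupport hrc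
    have hηi : Integrable η := hψi.sub (hri.const_mul m)
    have hη0 : ∫ x, η x = 0 := by
      change ∫ x, (ψ x - m * r x) = 0
      rw [integral_sub hψi (hri.const_mul m), integral_const_mul, hr1, ← hm]; ring
    let φ : ℝ → ℝ := fun x => ∫ t in Set.Iic x, η t
    obtain ⟨R, hR⟩ : ∃ R : ℝ, tsupport η ⊆ Set.Ioo (-R) R := by
      obtain ⟨R, hR⟩ := hηc.isBounded.subset_ball (0 : ℝ)
      exact ⟨R, by simpa [Real.ball_eq_Ioo] using hR⟩
    have hηz : ∀ x, x ∉ Set.Ioo (-R) R → η x = 0 := fun x hx =>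
      image_eq_zero_of_notMem_tsupport fun h => hx (hR h)
    have hφ' : ∀ x, HasDerivAt φ (η x) x := by
      intro x
      have h0 : φ = fun y => (∫ t in Set.Iic 0, η t) + ∫ t in (0 : ℝ)..y, η t := by
        ext y
        rw [← intervalIntegral.integral_Iic_sub_Iic hηi.integrableOn hηi.integrableOn]
        simp [φ]
      rw [h0]
      exact (intervalIntegral.integral_hasDerivAt_right (hη.continuous.intervalIntegrable _ _)
        (hη.continuous.stronglyMeasurableAtFilter _ _) hη.continuous.continuousAt).const_add _
    have hφd : deriv φ = η := funext fun x => (hφ' x).deriv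
    have hφ : ContDiff ℝ ∞ φ := by
      rw [contDiff_infty_iff_deriv, hφd]
      exact ⟨fun x => (hφ' x).differentiableAt, hη⟩
    have hφc : HasCompactSupport φ := by
      refine HasCompactSupport.intro (isCompact_Icc (a := -R) (b := R)) fun x hx => ?_
      rcases le_or_gt x (-R) with hx1 | hx1
      · refine setIntegral_eq_zero_of_forall_eq_zero fun t ht => hηz t fun h => ?_
        exact absurd h.1 (not_lt.2 (le_trans ht hx1))
      · have hx2 : R < x := by
          by_contra hcon
          exact hx ⟨hx1.le, not_lt.1 hcon⟩
        change ∫ t in Set.Iic x, η t = 0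
        rw [← hη0]
        refine setIntegral_eq_integral_of_forall_compl_eq_zero fun t ht => hηz t fun h => ?_
        exact ht (le_trans h.2.le hx2.le)
    have hw := h.integral_eq φ hφ hφc
    simp only [hφd, smul_zero, integral_zero, neg_zero] at hw
    have hi1 : Integrable fun x => ψ x • f x :=
      h.left.integrable_smul_left_of_hasCompactSupport hψ.continuous hψc
    have hi2 : Integrable fun x => r x • f x :=
      h.left.integrable_smul_left_of_hasCompactSupport hr.continuous hrc
    have h3 : ∫ x, ψ x • f x = m • ∫ x, r x • f x := by
      have h4 : ∀ x, η x • f x = ψ x • f x - m • (r x • f x) := fun x => by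
        simp only [η, sub_smul, mul_smul]
      simp only [h4] at hw
      have h5 := integral_sub hi1 (hi2.smul m)
      simp only [Pi.smul_apply] at h5
      rw [h5, integral_smul, sub_eq_zero] at hw
      exact hw
    simp only [smul_sub]
    rw [integral_sub hi1 (hψi.smul_const _), h3, integral_smul_const, sub_self]
  filter_upwards [hz] with x hx
  exact sub_eq_zero.1 hx

omit [CompleteSpace E] in
theorem HasWeakDeriv.sub {f g f' g' : ℝ → E} (h : HasWeakDeriv f g) (h' : HasWeakDeriv f' g') :
    HasWeakDeriv (fun x => f x - f' x) (fun x => g x - g' x) := by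
  have := h.add (h'.const_smul (-1))
  simpa [sub_eq_add_neg] using this

/-- Weak derivatives are unique. -/
theorem HasWeakDeriv.unique {f g g' : ℝ → E} (h : HasWeakDeriv f g) (h' : HasWeakDeriv f g') :
    g =ᵐ[volume] g' := by
  have h1 := (h.sub h').ae_eq_zero (Filter.Eventually.of_forall fun x => sub_self _)
  filter_upwards [h1] with x hx
  exact sub_eq_zero.1 hx

/-- Subtracting the primitive of `g` leaves a function with zero weak derivative, hence a constant.
-/
theorem HasWeakDeriv.ae_eq_primitive {f g : ℝ → E} (h : HasWeakDeriv f g) :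
    ∃ c : E, f =ᵐ[volume] fun x => c + ∫ t in (0 : ℝ)..x, g t := by
  have h1 := h.sub (hasWeakDeriv_primitive h.right 0)
  simp only [sub_self] at h1
  obtain ⟨c, hc⟩ := h1.ae_eq_const
  refine ⟨c, ?_⟩
  filter_upwards [hc] with x hx
  rw [← hx]
  simp

omit [NormedSpace ℝ E] [IsScalarTower ℝ ℂ E] [CompleteSpace E] [NormedSpace ℝ F]
  [IsScalarTower ℝ ℂ F] [CompleteSpace F] in
theorem locallyIntegrable_clm_apply {f : ℝ → E} (hf : LocallyIntegrable f) {a : ℝ → E →L[ℂ] F}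
    (ha : Continuous a) : LocallyIntegrable fun x => a x (f x) := by
  intro x
  obtain ⟨s, hs, hfs⟩ := hf x
  obtain ⟨K, hK, hKx⟩ := exists_compact_mem_nhds x
  obtain ⟨C, hC⟩ := hK.exists_bound_of_continuousOn ha.continuousOn
  refine ⟨K ∩ s, Filter.inter_mem hKx hs, ?_⟩
  have hfm : IntegrableOn f (K ∩ s) := hfs.mono_set Set.inter_subset_right
  have hm : AEStronglyMeasurable (fun x => a x (f x)) (volume.restrict (K ∩ s)) :=
    isBoundedBilinearMap_apply.continuous.comp_aestronglyMeasurable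
      (ha.aestronglyMeasurable.prodMk hfm.aestronglyMeasurable)
  refine (hfm.norm.const_mul C).mono' hm ?_
  have hmem : ∀ᵐ y ∂(volume.restrict (K ∩ s)), y ∈ K :=
    ae_restrict_of_ae_restrict_of_subset Set.inter_subset_left
      (ae_restrict_mem hK.measurableSet)
  filter_upwards [hmem] with y hy
  exact (a y).le_of_opNorm_le (hC y hy) _

/-- Product rule for a `C¹` operator-valued function and a weakly differentiable function. -/
theorem HasWeakDeriv.clm_apply {f g : ℝ → E} (h : HasWeakDeriv f g) {a : ℝ → E →L[ℂ] F}
    (ha : ContDiff ℝ 1 a) :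
    HasWeakDeriv (fun x => a x (f x)) (fun x => deriv a x (f x) + a x (g x)) where
  left := locallyIntegrable_clm_apply h.left ha.continuous
  right := (locallyIntegrable_clm_apply h.left (ha.continuous_deriv le_rfl)).add
    (locallyIntegrable_clm_apply h.right ha.continuous)
  integral_eq φ hφ hc := by
    obtain ⟨c, hf⟩ := h.ae_eq_primitive
    have hφ1 : ContDiff ℝ 1 φ := hφ.of_le (by norm_num)
    have hd : ∀ x, deriv (fun y => φ y • a y) x = φ x • deriv a x + deriv φ x • a x := fun x =>
      ((hφ1.differentiable one_ne_zero x).hasDerivAt.smul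
        (ha.differentiable one_ne_zero x).hasDerivAt).deriv
    -- The coefficient is absorbed into the test function: φa is a compactly supported `C¹`
    -- operator-valued function.
    have key := integral_deriv_clm_primitive h.right (hφ1.smul ha) hc.smul_right c
    have key2 : ∫ x, deriv (fun y => φ y • a y) x (f x) = -∫ x, (φ x • a x) (g x) := by
      refine Eq.trans (integral_congr_ae ?_) key
      filter_upwards [hf] with x hx
      rw [hx]
      rfl
    have hda := ha.continuous_deriv le_rfl
    have i1 := (locallyIntegrable_clm_apply h.left hda).integrable_smul_left_of_hasCompactSupport
      hφ.continuous hc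
    have i2 := (locallyIntegrable_clm_apply h.left
      ha.continuous).integrable_smul_left_of_hasCompactSupport
      (hφ.continuous_deriv (by norm_num)) hc.deriv
    have i3 := (locallyIntegrable_clm_apply h.right
      ha.continuous).integrable_smul_left_of_hasCompactSupport hφ.continuous hc
    simp only [hd, add_apply, smul_apply] at key2
    rw [integral_add i1 i2] at key2
    simp only [smul_add]
    rw [integral_add i1 i3, neg_add, ← key2]
    abel

/-- A continuous linear map commutes with weak derivatives. -/
theorem HasWeakDeriv.clm_comp {f g : ℝ → E} (h : HasWeakDeriv f g) (a : E →L[ℂ] F) :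
    HasWeakDeriv (fun x => a (f x)) (fun x => a (g x)) := by
  simpa using h.clm_apply (a := fun _ => a) contDiff_const

/-- A classical `C¹` derivative is a weak derivative. -/
theorem hasWeakDeriv_of_hasDerivAt {f g : ℝ → E} (h : ∀ x, HasDerivAt f (g x) x)
    (hg : Continuous g) : HasWeakDeriv f g := by
  have h1 : f = fun x => f 0 + ∫ t in (0 : ℝ)..x, g t := by
    ext x
    rw [intervalIntegral.integral_eq_sub_of_hasDerivAt (fun t _ => h t)
      (hg.intervalIntegrable _ _)]
    abel
  rw [h1]
  exact hasWeakDeriv_primitive hg.locallyIntegrable _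

end WeakCalculus

/-! ### Linear differential equations in Banach spaces -/

section LinearODE

open scoped BoundedContinuousFunction in
/-- Global existence for a linear differential equation with bounded continuous coefficients. -/
theorem exists_linear_ode_solution {E : Type*} [NormedAddCommGroup E] [NormedSpace ℝ E]
    [CompleteSpace E] {a : ℝ → E →L[ℝ] E} (ha : Continuous a) {K : ℝ} (hK : ∀ x, ‖a x‖ ≤ K)
    (w₀ : E) : ∃ W : ℝ → E, (∀ x, HasDerivAt W (a x (W x)) x) ∧ W 0 = w₀ := by
  have hK0 : 0 ≤ K := (norm_nonneg _).trans (hK 0)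
  -- The solution is sought as cosh(cx) U(x) with U bounded. In this weight the Picard map has
  -- Lipschitz constant at most K/c ≤ 1/2 on the whole line; the summand 1 keeps c positive when K =
  -- 0.
  set c : ℝ := 2 * K + 1 with hc
  have hc0 : 0 < c := by positivity
  have hcosh : Continuous fun x : ℝ => Real.cosh (c * x) := by fun_prop
  have hcosh0 : ∀ x : ℝ, 0 < Real.cosh (c * x) := fun x => Real.cosh_pos _
  have hint : ∀ x : ℝ, |∫ y in (0 : ℝ)..x, Real.cosh (c * y)| ≤ Real.cosh (c * x) / c := by
    intro x
    have h1 : ∀ y : ℝ, HasDerivAt (fun y => Real.sinh (c * y) / c) (Real.cosh (c * y)) y := by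
      intro y
      have := ((Real.hasDerivAt_sinh (c * y)).comp y ((hasDerivAt_id y).const_mul c)).div_const c
      simpa [hc0.ne', mul_div_assoc] using this
    rw [intervalIntegral.integral_eq_sub_of_hasDerivAt (fun y _ => h1 y)
      (hcosh.intervalIntegrable _ _)]
    simp only [mul_zero, Real.sinh_zero, zero_div, sub_zero, abs_div, abs_of_pos hc0]
    gcongr
    rw [Real.abs_sinh, ← Real.cosh_abs]
    exact (Real.sinh_lt_cosh _).le
  have hcont : ∀ U : ℝ →ᵇ E, Continuous fun y => a y (Real.cosh (c * y) • U y) := fun U =>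
    ha.clm_apply (hcosh.smul U.continuous)
  have hbd : ∀ (U : ℝ →ᵇ E) (x : ℝ),
      ‖∫ y in (0 : ℝ)..x, a y (Real.cosh (c * y) • U y)‖ ≤ K * ‖U‖ * (Real.cosh (c * x) / c) := by
    intro U x
    have h1 : ∀ y, ‖a y (Real.cosh (c * y) • U y)‖ ≤ K * ‖U‖ * Real.cosh (c * y) := by
      intro y
      refine ((a y).le_of_opNorm_le (hK y) _).trans ?_
      rw [norm_smul, Real.norm_of_nonneg (hcosh0 y).le, mul_assoc, mul_comm ‖U‖]
      have := U.norm_coe_le_norm y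
      have := (hcosh0 y).le
      gcongr
    refine (intervalIntegral.norm_integral_le_abs_of_norm_le
      (Filter.Eventually.of_forall h1)
      ((continuous_const.mul hcosh).intervalIntegrable _ _)).trans ?_
    rw [intervalIntegral.integral_const_mul, abs_mul, abs_of_nonneg (by positivity)]
    gcongr
    exact hint x
  let G₀ : (ℝ →ᵇ E) → ℝ → E := fun U x =>
    (Real.cosh (c * x))⁻¹ • (w₀ + ∫ y in (0 : ℝ)..x, a y (Real.cosh (c * y) • U y))
  have hGc : ∀ U, Continuous (G₀ U) := fun U =>
    (hcosh.inv₀ fun x => (hcosh0 x).ne').smul (continuous_const.add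
      (intervalIntegral.continuous_primitive (fun _ _ => (hcont U).intervalIntegrable _ _) 0))
  have hGb : ∀ U x, ‖G₀ U x‖ ≤ ‖w₀‖ + K * ‖U‖ / c := by
    intro U x
    simp only [G₀]
    rw [norm_smul, norm_inv, Real.norm_of_nonneg (hcosh0 x).le, inv_mul_le_iff₀ (hcosh0 x)]
    refine (norm_add_le _ _).trans ?_
    rw [mul_add]
    refine add_le_add ?_ ((hbd U x).trans (le_of_eq (by ring)))
    exact le_mul_of_one_le_left (norm_nonneg _) (Real.one_le_cosh _)
  let G : (ℝ →ᵇ E) → (ℝ →ᵇ E) := fun U =>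
    BoundedContinuousFunction.ofNormedAddCommGroup (G₀ U) (hGc U) _ (hGb U)
  have hG : ContractingWith (1 / 2) G := by
    refine ⟨by norm_num, LipschitzWith.of_dist_le_mul fun U U' => ?_⟩
    rw [BoundedContinuousFunction.dist_le (by positivity)]
    intro x
    have h1 : G U x - G U' x = (Real.cosh (c * x))⁻¹ •
        ∫ y in (0 : ℝ)..x, a y (Real.cosh (c * y) • (U - U') y) := by
      change G₀ U x - G₀ U' x = _
      simp only [G₀]
      rw [← smul_sub, add_sub_add_left_eq_sub, ← intervalIntegral.integral_sub
        ((hcont U).intervalIntegrable _ _) ((hcont U').intervalIntegrable _ _)]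
      simp [smul_sub]
    rw [dist_eq_norm, h1, norm_smul, norm_inv, Real.norm_of_nonneg (hcosh0 x).le,
      inv_mul_le_iff₀ (hcosh0 x), dist_eq_norm]
    refine (hbd _ x).trans ?_
    have h2 : K / c ≤ 1 / 2 := by
      rw [div_le_iff₀ hc0]; linarith
    calc K * ‖U - U'‖ * (Real.cosh (c * x) / c)
        = K / c * (‖U - U'‖ * Real.cosh (c * x)) := by ring
      _ ≤ 1 / 2 * (‖U - U'‖ * Real.cosh (c * x)) := by gcongr
      _ = _ := by push_cast; ring
  obtain ⟨U, hU⟩ : ∃ U, G U = U := ⟨_, hG.fixedPoint_isFixedPt⟩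
  have hUx : ∀ x, Real.cosh (c * x) • U x =
      w₀ + ∫ y in (0 : ℝ)..x, a y (Real.cosh (c * y) • U y) := by
    intro x
    have h1 : U x = G₀ U x := (DFunLike.congr_fun hU x).symm
    conv_lhs => rw [h1]
    simp only [G₀]
    rw [smul_smul, mul_inv_cancel₀ (hcosh0 x).ne', one_smul]
  refine ⟨fun x => Real.cosh (c * x) • U x, fun x => ?_, ?_⟩
  · have hd := (intervalIntegral.integral_hasDerivAt_right ((hcont U).intervalIntegrable 0 x)
      ((hcont U).stronglyMeasurableAtFilter volume (nhds x)) (hcont U).continuousAt).const_add w₀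
    rwa [← funext hUx] at hd
  · simpa using hUx 0

/-- A fundamental solution of a linear equation in a Banach algebra, with a left inverse which
solves the adjoint equation. -/
theorem exists_fundamental_pair {R : Type*} [NormedRing R] [NormedSpace ℝ R] [IsScalarTower ℝ R R]
    [SMulCommClass ℝ R R] [CompleteSpace R] {a : ℝ → R} (ha : Continuous a) {K : ℝ} (hK : ∀ x, ‖a x‖ ≤ K) :
    ∃ U V : ℝ → R, (∀ x, HasDerivAt U (a x * U x) x) ∧ (∀ x, HasDerivAt V (-(V x * a x)) x) ∧
      U 0 = 1 ∧ V 0 = 1 := by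
  obtain ⟨U, hU, hU0⟩ := exists_linear_ode_solution (a := fun x => ContinuousLinearMap.mul ℝ R (a x))
    ((ContinuousLinearMap.mul ℝ R).continuous.comp ha)
    (fun x => ((ContinuousLinearMap.opNorm_mul_apply_le ℝ R (a x))).trans (hK x)) (1 : R)
  obtain ⟨V, hV, hV0⟩ := exists_linear_ode_solution
    (a := fun x => (ContinuousLinearMap.mul ℝ R).flip (-a x))
    ((ContinuousLinearMap.mul ℝ R).flip.continuous.comp ha.neg)
    (K := K) (fun x => by
      refine ContinuousLinearMap.opNorm_le_bound _ ((norm_nonneg _).trans (hK x)) fun y => ?_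
      simp only [ContinuousLinearMap.flip_apply, ContinuousLinearMap.mul_apply']
      refine (norm_mul_le _ _).trans ?_
      rw [norm_neg, mul_comm]
      gcongr
      exact hK x) (1 : R)
  exact ⟨U, V, by simpa using hU, by simpa using hV, hU0, hV0⟩

/-- The derivative of V U is -V a U + V a U = 0. This single identity yields the inverse of the
fundamental solution, its uniqueness and the Floquet relation. -/
theorem adjoint_mul_solution_const {R : Type*} [NormedRing R] [NormedSpace ℝ R] [IsScalarTower ℝ R R]
    [SMulCommClass ℝ R R] {a U V : ℝ → R} (hU : ∀ x, HasDerivAt U (a x * U x) x)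
    (hV : ∀ x, HasDerivAt V (-(V x * a x)) x) (x : ℝ) : V x * U x = V 0 * U 0 := by
  have h : ∀ y, HasDerivAt (fun y => V y * U y) 0 y := fun y => by
    have := (ContinuousLinearMap.mul ℝ R).hasDerivAt_of_bilinear (fun _ => hV y) (fun _ => hU y)
    simpa [mul_assoc] using this
  exact is_const_of_deriv_eq_zero (fun y => (h y).differentiableAt) (fun y => (h y).deriv) x 0

end LinearODE

/-! ### The shift on ℓ^p(ℤ) and the operator S - M -/

section Shift

variable {V : Type*} [NormedAddCommGroup V] [NormedSpace ℂ V] {p : ℝ≥0∞} [Fact (1 ≤ p)]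

/-- Translation by `m` on `ℓ^p(ℤ)`. -/
def shift (V : Type*) [NormedAddCommGroup V] [NormedSpace ℂ V] (p : ℝ≥0∞) [Fact (1 ≤ p)]
    (m : ℤ) : Lp V p (Measure.count : Measure ℤ) →L[ℂ] Lp V p (Measure.count : Measure ℤ) :=
  (Lp.compMeasurePreservingₗᵢ ℂ (fun k : ℤ => k + m)
    (measurePreserving_add_right Measure.count m)).toContinuousLinearMap

-- Only the empty set is null for counting measure, so classes in ℓ^p(ℤ) can be compared point by
-- point.
omit [NormedSpace ℂ V] [Fact (1 ≤ p)] in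
theorem coeFn_count_ext {f g : Lp V p (Measure.count : Measure ℤ)} (h : ∀ k, f k = g k) : f = g :=
  Lp.ext (Filter.Eventually.of_forall h)

theorem shift_apply (m : ℤ) (f : Lp V p (Measure.count : Measure ℤ)) (k : ℤ) :
    shift V p m f k = f (k + m) :=
  Measure.ae_count_iff.1 (Lp.coeFn_compMeasurePreserving f
    (measurePreserving_add_right (Measure.count : Measure ℤ) m)) k

theorem norm_shift_le (m : ℤ) : ‖shift V p m‖ ≤ 1 :=
  LinearIsometry.norm_toContinuousLinearMap_le _

theorem shift_mul (l m : ℤ) : shift V p l * shift V p m = shift V p (l + m) := by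
  ext1 f
  refine coeFn_count_ext fun k => ?_
  rw [mul_apply_eq_comp, shift_apply, shift_apply, shift_apply, add_assoc]

theorem shift_zero : shift V p 0 = 1 := by
  ext1 f
  refine coeFn_count_ext fun k => ?_
  rw [shift_apply, add_zero]
  rfl

theorem compLpL_count_apply (M : V →L[ℂ] V) (f : Lp V p (Measure.count : Measure ℤ)) (k : ℤ) :
    M.compLpL p Measure.count f k = M (f k) :=
  Measure.ae_count_iff.1 (M.coeFn_compLpL f) k

/-- Pointwise application of operators, as a homomorphism of algebras. -/
def pointwise (V : Type*) [NormedAddCommGroup V] [NormedSpace ℂ V] (p : ℝ≥0∞) [Fact (1 ≤ p)] :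
    (V →L[ℂ] V) →ₐ[ℂ]
      (Lp V p (Measure.count : Measure ℤ) →L[ℂ] Lp V p (Measure.count : Measure ℤ)) :=
  AlgHom.ofLinearMap
    { toFun := fun M => M.compLpL p Measure.count
      map_add' := fun M N => ContinuousLinearMap.add_compLpL M N
      map_smul' := fun c M => ContinuousLinearMap.smul_compLpL c M }
    (by
      ext1 f
      refine coeFn_count_ext fun k => ?_
      exact compLpL_count_apply 1 f k)
    (fun M N => by
      ext1 f
      refine coeFn_count_ext fun k => ?_
      change (M * N).compLpL p Measure.count f k =
        (M.compLpL p Measure.count) (N.compLpL p Measure.count f) k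
      rw [compLpL_count_apply, compLpL_count_apply, compLpL_count_apply]
      rfl)

theorem pointwise_apply (M : V →L[ℂ] V) (f : Lp V p (Measure.count : Measure ℤ)) (k : ℤ) :
    pointwise V p M f k = M (f k) :=
  compLpL_count_apply M f k

theorem commute_shift_pointwise (m : ℤ) (M : V →L[ℂ] V) :
    Commute (shift V p m) (pointwise V p M) := by
  change _ * _ = _ * _
  ext1 f
  refine coeFn_count_ext fun k => ?_
  rw [mul_apply_eq_comp, mul_apply_eq_comp, shift_apply, pointwise_apply,
    pointwise_apply, shift_apply]

theorem isUnit_one_sub_smul {R : Type*} [NormedRing R] [NormedAlgebra ℂ R]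
    [CompleteSpace R] {a : R} (ha : ‖a‖ ≤ 1) {μ : ℂ} (hμ : ‖μ‖ < 1) : IsUnit (1 - μ • a) :=
  isUnit_one_sub_of_norm_lt_one <| (norm_smul_le _ _).trans_lt <|
    (mul_le_of_le_one_right (norm_nonneg _) ha).trans_lt hμ

theorem isUnit_sub_algebraMap_of_norm_lt {R : Type*} [NormedRing R] [NormedAlgebra ℂ R]
    [CompleteSpace R] {a : R} (ha : ‖a‖ ≤ 1) {μ : ℂ} (hμ : 1 < ‖μ‖) :
    IsUnit (algebraMap ℂ R μ - a) := by
  have hμ0 : μ ≠ 0 := by rintro rfl; norm_num at hμ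
  have h1 : IsUnit (1 - μ⁻¹ • a) :=
    isUnit_one_sub_smul ha (by rw [norm_inv]; exact inv_lt_one_of_one_lt₀ hμ)
  have h2 : algebraMap ℂ R μ - a = algebraMap ℂ R μ * (1 - μ⁻¹ • a) := by
    rw [mul_sub, mul_one, Algebra.smul_def, ← mul_assoc, ← map_mul, mul_inv_cancel₀ hμ0, map_one,
      one_mul]
  rw [h2]
  exact ((isUnit_iff_ne_zero.2 hμ0).map (algebraMap ℂ R)).mul h1

/-- S and S⁻¹ both have norm at most one: S - μ is inverted by a Neumann series in S/μ when |μ| > 1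
and in μS⁻¹ when |μ| < 1. -/
theorem norm_eq_one_of_mem_spectrum_shift [CompleteSpace V] {μ : ℂ}
    (hμ : μ ∈ _root_.spectrum ℂ (shift V p 1)) : ‖μ‖ = 1 := by
  by_contra hne
  refine hμ ?_
  rcases lt_or_gt_of_ne hne with h | h
  · have hu : IsUnit (shift V p 1) :=
      ⟨⟨shift V p 1, shift V p (-1), by rw [shift_mul, add_neg_cancel, shift_zero],
        by rw [shift_mul, neg_add_cancel, shift_zero]⟩, rfl⟩
    have h1 : IsUnit (1 - μ • shift V p (-1)) := isUnit_one_sub_smul (norm_shift_le _) h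
    have h2 : algebraMap ℂ _ μ - shift V p 1 = -(shift V p 1 * (1 - μ • shift V p (-1))) := by
      rw [mul_sub, mul_one, mul_smul_comm, shift_mul, add_neg_cancel, shift_zero, neg_sub,
        Algebra.algebraMap_eq_smul_one]
    change IsUnit (algebraMap ℂ _ μ - shift V p 1)
    rw [h2]
    exact (hu.mul h1).neg
  · exact isUnit_sub_algebraMap_of_norm_lt (norm_shift_le 1) h

/-- For monomials this is the factorization of sⁿ - mⁿ by a geometric sum; linearity does the rest.
Commutativity allows the same cofactor on both sides. -/
theorem exists_aeval_sub_aeval_eq {R : Type*} [Ring R] [Algebra ℂ R] {s m : R} (h : Commute s m)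
    (P : Polynomial ℂ) : ∃ c, (s - m) * c = Polynomial.aeval s P - Polynomial.aeval m P ∧
      c * (s - m) = Polynomial.aeval s P - Polynomial.aeval m P := by
  induction P using Polynomial.induction_on' with
  | add P Q hP hQ =>
    obtain ⟨c, h1, h2⟩ := hP
    obtain ⟨d, h3, h4⟩ := hQ
    refine ⟨c + d, ?_, ?_⟩
    · rw [mul_add, h1, h3, map_add, map_add]; abel
    · rw [add_mul, h2, h4, map_add, map_add]; abel
  | monomial n r =>
    refine ⟨r • ∑ i ∈ Finset.range n, s ^ i * m ^ (n - 1 - i), ?_, ?_⟩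
    · rw [mul_smul_comm, h.mul_geom_sum₂, Polynomial.aeval_monomial, Polynomial.aeval_monomial,
        smul_sub, Algebra.smul_def, Algebra.smul_def]
    · rw [smul_mul_assoc, h.geom_sum₂_mul, Polynomial.aeval_monomial, Polynomial.aeval_monomial,
        smul_sub, Algebra.smul_def, Algebra.smul_def]

/-- If a monic polynomial annihilates `M` and has no root of modulus one, then `z ↦ z(· + 1) - M z`
is invertible on `ℓ^p(ℤ)`. -/
theorem isUnit_shift_sub_pointwise [CompleteSpace V] {M : V →L[ℂ] V} {P : Polynomial ℂ}
    (hP : P.Monic) (hPM : Polynomial.aeval M P = 0) (hroot : ∀ μ, P.eval μ = 0 → ‖μ‖ ≠ 1) :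
    IsUnit (shift V p 1 - pointwise V p M) := by
  obtain ⟨c, h1, h2⟩ := exists_aeval_sub_aeval_eq (commute_shift_pointwise (p := p) 1 M) P
  have h0 : Polynomial.aeval (pointwise V p M) P = 0 := by
    rw [Polynomial.aeval_algHom_apply, hPM, map_zero]
  rw [h0, sub_zero] at h1 h2
  -- P(S) is a product of factors S - μ over the roots of P; if it were not invertible, some root
  -- would lie in the spectrum of S, hence on the unit circle.
  have hu : IsUnit (Polynomial.aeval (shift V p 1) P) := by
    by_contra hcon
    have hs := (IsAlgClosed.splits P).eq_prod_roots
    rw [hP.leadingCoeff, map_one, one_mul] at hs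
    rw [hs] at hcon
    obtain ⟨μ, hμ, hμ0⟩ := spectrum.exists_mem_of_not_isUnit_aeval_prod hcon
    exact hroot μ hμ0 (norm_eq_one_of_mem_spectrum_shift hμ)
  -- The cofactor c times P(S)⁻¹, in the two orders, is a right and a left inverse of S - M.
  exact isUnit_iff_exists_and_exists.2
    ⟨⟨c * ↑hu.unit⁻¹, by rw [← mul_assoc, h1]; exact hu.mul_val_inv⟩,
      ⟨↑hu.unit⁻¹ * c, by rw [mul_assoc, h2]; exact hu.val_inv_mul⟩⟩

end Shift

theorem exists_norm_bound_of_periodic {X : Type*} [NormedAddCommGroup X] {f : ℝ → X} {T : ℝ}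
    (hf : Continuous f) (hp : Function.Periodic f T) (hT : 0 < T) : ∃ C, ∀ x, ‖f x‖ ≤ C := by
  obtain ⟨C, hC⟩ := (isCompact_Icc (a := (0 : ℝ)) (b := T)).exists_bound_of_continuousOn
    hf.continuousOn
  refine ⟨C, fun x => ?_⟩
  obtain ⟨t, ht, hte⟩ := hp.exists_mem_Ico₀ hT x
  rw [hte]
  exact hC t ⟨ht.1, ht.2.le⟩

/-! ### Period cells: passing between L^p(ℝ) and ℓ^p(ℤ) -/

section Cells

variable {T : ℝ}

/-- The period cell `[kT, (k+1)T)`. -/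
def cell (T : ℝ) (k : ℤ) : Set ℝ := (fun x : ℝ => ⌊x / T⌋) ⁻¹' {k}

theorem measurable_floor_div (T : ℝ) : Measurable fun x : ℝ => ⌊x / T⌋ :=
  Int.measurable_floor.comp (measurable_id.div_const T)

theorem measurableSet_cell (T : ℝ) (k : ℤ) : MeasurableSet (cell T k) :=
  measurable_floor_div T (measurableSet_singleton k)

theorem cell_eq_Ico (hT : 0 < T) (k : ℤ) : cell T k = Set.Ico (k * T) ((k + 1) * T) := by
  ext x
  simp only [cell, Set.mem_preimage, Set.mem_singleton_iff, Int.floor_eq_iff, Set.mem_Ico]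
  rw [le_div_iff₀ hT, div_lt_iff₀ hT]

theorem volume_cell (hT : 0 < T) (k : ℤ) : volume (cell T k) = ENNReal.ofReal T := by
  rw [cell_eq_Ico hT, Real.volume_Ico]
  congr 1
  ring

/-- Every cell has length T. This pushforward identifies L^p norms of functions constant on cells
with ℓ^p norms. -/
theorem map_floor_div (hT : 0 < T) :
    Measure.map (fun x : ℝ => ⌊x / T⌋) volume = ENNReal.ofReal T • Measure.count := by
  refine Measure.ext_of_singleton fun k => ?_
  rw [Measure.map_apply (measurable_floor_div T) (measurableSet_singleton k)]
  rw [Measure.smul_apply, Measure.count_singleton, smul_eq_mul, mul_one]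
  exact volume_cell hT k

theorem eLpNorm_comp_floor_div {ε : Type*} [TopologicalSpace ε] [ContinuousENorm ε] (hT : 0 < T)
    (p : ℝ≥0∞) (z : ℤ → ε) : eLpNorm (fun x : ℝ => z ⌊x / T⌋) p volume =
      ENNReal.ofReal T ^ (1 / p).toReal * eLpNorm z p Measure.count := by
  rw [← smul_eq_mul, ← eLpNorm_smul_measure_of_ne_zero (by simpa using hT), ← map_floor_div hT,
    eLpNorm_map_measure AEStronglyMeasurable.of_discrete (measurable_floor_div T).aemeasurable]
  rfl

theorem tsum_lintegral_cell (T : ℝ) (φ : ℝ → ℝ≥0∞) :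
    ∑' k, ∫⁻ x in cell T k, φ x = ∫⁻ x, φ x := by
  rw [← lintegral_iUnion (measurableSet_cell T)]
  · have : ⋃ k, cell T k = Set.univ := Set.eq_univ_of_forall fun x =>
      Set.mem_iUnion.2 ⟨⌊x / T⌋, rfl⟩
    rw [this, setLIntegral_univ]
  · intro i j hij
    exact Disjoint.preimage _ (Set.disjoint_singleton.2 hij)

/-- For finite p the p-th powers of the norms on the cells add up to that on the line, with
equality; for p = ∞ each local essential supremum is at most the global one. -/
theorem eLpNorm_eLpNorm_cell_le {V : Type*} [NormedAddCommGroup V] {p : ℝ≥0∞} (hp : 1 ≤ p)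
    (F : ℝ → V) :
    eLpNorm (fun k => eLpNorm F p (volume.restrict (cell T k))) p Measure.count ≤
      eLpNorm F p volume := by
  rcases eq_or_ne p ∞ with rfl | htop
  · rw [eLpNorm_exponent_top, eLpNormEssSup_count]
    exact iSup_le fun k => eLpNorm_restrict_le F ∞ volume _
  · have h0 : p ≠ 0 := (one_pos.trans_le hp).ne'
    have hr : 0 < p.toReal := ENNReal.toReal_pos h0 htop
    rw [eLpNorm_eq_lintegral_rpow_enorm_toReal h0 htop,
      eLpNorm_eq_lintegral_rpow_enorm_toReal h0 htop, lintegral_count,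
      ← tsum_lintegral_cell T fun x => ‖F x‖ₑ ^ p.toReal]
    refine le_of_eq ?_
    congr 2
    ext k
    rw [eLpNorm_eq_lintegral_rpow_enorm_toReal h0 htop, enorm_eq_self, ← ENNReal.rpow_mul,
      one_div_mul_cancel hr.ne', ENNReal.rpow_one]

/-- The integrals of an `L^p` function over the period cells form an `ℓ^p` sequence. -/
theorem eLpNorm_lintegral_cell_le {V : Type*} [NormedAddCommGroup V] {p : ℝ≥0∞} (hp : 1 ≤ p)
    (hT : 0 < T) {F : ℝ → V} (hF : AEStronglyMeasurable F volume) :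
    eLpNorm (fun k => ∫⁻ x in cell T k, ‖F x‖ₑ) p Measure.count ≤
      (T.toNNReal ^ (1 - 1 / p.toReal) : NNReal) * eLpNorm F p volume := by
  -- Hölder on a cell of length T. For p = ∞ the convention 1 / 0 = 0 gives the correct factor T.
  have h1 : ∀ k, ∫⁻ x in cell T k, ‖F x‖ₑ ≤ (T.toNNReal ^ (1 - 1 / p.toReal) : NNReal) *
      eLpNorm F p (volume.restrict (cell T k)) := by
    intro k
    rw [← eLpNorm_one_eq_lintegral_enorm]
    refine (eLpNorm_le_eLpNorm_mul_rpow_measure_univ hp hF.restrict).trans (le_of_eq ?_)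
    rw [Measure.restrict_apply_univ, volume_cell hT, mul_comm, ENNReal.toReal_one, div_one]
    congr 1
    rw [ENNReal.coe_rpow_of_ne_zero (by simpa using hT)]
    rfl
  refine (eLpNorm_le_nnreal_smul_eLpNorm_of_ae_le_mul'
    (g := fun k => eLpNorm F p (volume.restrict (cell T k)))
    (Filter.Eventually.of_forall fun k => by simpa only [enorm_eq_self] using h1 k) p).trans ?_
  rw [ENNReal.smul_def, smul_eq_mul]
  gcongr
  exact eLpNorm_eLpNorm_cell_le hp F

end Cells

/-! ### Floquet theory and absence of homogeneous L^p solutions -/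

section Floquet

variable {V : Type*} [NormedAddCommGroup V] [NormedSpace ℝ V] [NormedSpace ℂ V]
  [IsScalarTower ℝ ℂ V]

/-- `U` is the fundamental solution of `W' = a W`, where `a` is continuous and `T`-periodic, and
`Θ` is its inverse. -/
structure IsFloquetPair (T : ℝ) (a U Θ : ℝ → V →L[ℂ] V) : Prop where
  period_pos : 0 < T
  continuous_coeff : Continuous a
  periodic_coeff : Function.Periodic a T
  hasDerivAt : ∀ x, HasDerivAt U (a x * U x) x
  hasDerivAt_inv : ∀ x, HasDerivAt Θ (-(Θ x * a x)) x
  map_zero : U 0 = 1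
  inv_mul : ∀ x, Θ x * U x = 1
  mul_inv : ∀ x, U x * Θ x = 1

namespace IsFloquetPair

variable {T : ℝ} {a U Θ : ℝ → V →L[ℂ] V} {p : ℝ≥0∞}

theorem continuous (h : IsFloquetPair T a U Θ) : Continuous U :=
  continuous_iff_continuousAt.2 fun x => (h.hasDerivAt x).continuousAt

theorem continuous_inv (h : IsFloquetPair T a U Θ) : Continuous Θ :=
  continuous_iff_continuousAt.2 fun x => (h.hasDerivAt_inv x).continuousAt

theorem contDiff (h : IsFloquetPair T a U Θ) : ContDiff ℝ 1 U := by
  rw [contDiff_one_iff_deriv, funext fun x => (h.hasDerivAt x).deriv]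
  exact ⟨fun x => (h.hasDerivAt x).differentiableAt, h.continuous_coeff.mul h.continuous⟩

theorem contDiff_inv (h : IsFloquetPair T a U Θ) : ContDiff ℝ 1 Θ := by
  rw [contDiff_one_iff_deriv, funext fun x => (h.hasDerivAt_inv x).deriv]
  exact ⟨fun x => (h.hasDerivAt_inv x).differentiableAt,
    (h.continuous_inv.mul h.continuous_coeff).neg⟩

theorem inv_zero (h : IsFloquetPair T a U Θ) : Θ 0 = 1 := by
  simpa [h.map_zero] using h.inv_mul 0

/-- U(· + T) solves the same periodic equation, so Θ(x) U(x + T) is constant and equals its value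
U(T) at 0. -/
theorem map_add_period (h : IsFloquetPair T a U Θ) (x : ℝ) : U (x + T) = U x * U T := by
  have h1 : ∀ x, HasDerivAt (fun y => U (y + T)) (a x * U (x + T)) x := fun x => by
    have := (h.hasDerivAt (x + T)).comp_add_const x T
    rwa [h.periodic_coeff x] at this
  have h2 := adjoint_mul_solution_const (R := V →L[ℂ] V) h1 h.hasDerivAt_inv x
  rw [zero_add, h.inv_zero, one_mul] at h2
  rw [← h2, ← mul_assoc, h.mul_inv, one_mul]

theorem inv_add_period (h : IsFloquetPair T a U Θ) (x : ℝ) : Θ (x + T) = Θ T * Θ x := by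
  have h1 : U (x + T) * (Θ T * Θ x) = 1 := by
    rw [h.map_add_period, mul_assoc, ← mul_assoc (U T), h.mul_inv, one_mul, h.mul_inv]
  rw [← mul_one (Θ (x + T)), ← h1, ← mul_assoc, h.inv_mul, one_mul]

/-- The propagator `U x * Θ y` is invariant under simultaneous translation by a period. -/
theorem propagator_periodic (h : IsFloquetPair T a U Θ) (x y : ℝ) :
    Function.Periodic (fun t => U (t + x) * Θ (t + y)) T := by
  intro t
  simp only
  rw [add_right_comm, h.map_add_period, add_right_comm, h.inv_add_period, mul_assoc,
    ← mul_assoc (U T), h.mul_inv, one_mul]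

theorem propagator_add_int_mul (h : IsFloquetPair T a U Θ) (x y : ℝ) (k : ℤ) :
    U (k * T + x) * Θ (k * T + y) = U x * Θ y := by
  have := (h.propagator_periodic x y).int_mul k 0
  simpa using this

/-- Simultaneous translation by periods brings y into [0, T); what remains is a continuous function
on a compact set. -/
theorem exists_propagator_bound (h : IsFloquetPair T a U Θ) :
    ∃ C : NNReal, ∀ x y, |x - y| ≤ T → ‖U x * Θ y‖ ≤ C := by
  have hc : Continuous fun z : ℝ × ℝ => U (z.1 + z.2) * Θ z.1 :=
    (h.continuous.comp (continuous_fst.add continuous_snd)).mul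
      (h.continuous_inv.comp continuous_fst)
  obtain ⟨C, hC⟩ := (isCompact_Icc (a := (0 : ℝ)) (b := T)).prod
    (isCompact_Icc (a := -T) (b := T)) |>.exists_bound_of_continuousOn hc.continuousOn
  refine ⟨C.toNNReal, fun x y hxy => ?_⟩
  refine le_trans ?_ (Real.le_coe_toNNReal C)
  have hper : Function.Periodic (fun t => U (t + (x - y)) * Θ t) T := by
    simpa using h.propagator_periodic (x - y) 0
  obtain ⟨t, ht, hte⟩ := hper.exists_mem_Ico₀ h.period_pos y
  simp only [add_sub_cancel] at hte
  rw [hte]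
  exact hC (t, x - y) ⟨⟨ht.1, ht.2.le⟩, abs_le.1 hxy⟩

variable [CompleteSpace V]

/-- In the absence of multipliers of modulus one, `W' = a W` has no nonzero `L^p` solution. -/
theorem ae_eq_zero_of_memLp [Fact (1 ≤ p)] (h : IsFloquetPair T a U Θ)
    {P : Polynomial ℂ} (hP : P.Monic) (hPM : Polynomial.aeval (U T) P = 0)
    (hroot : ∀ μ, P.eval μ = 0 → ‖μ‖ ≠ 1) {W : ℝ → V} (hW : HasWeakDeriv W fun x => a x (W x))
    (hWp : MemLp W p volume) : W =ᵐ[volume] fun _ => 0 := by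
  have hT := h.period_pos
  -- Variation of constants: ΘW has zero weak derivative, so W = Uc almost everywhere.
  have hY := hW.clm_apply h.contDiff_inv
  have hY0 : (fun x => deriv Θ x (W x) + Θ x (a x (W x))) = fun _ => 0 := by
    ext1 x
    rw [(h.hasDerivAt_inv x).deriv, neg_apply, mul_apply_eq_comp, neg_add_cancel]
  rw [hY0] at hY
  obtain ⟨c, hc⟩ := hY.ae_eq_const
  have hWc : ∀ᵐ x, W x = U x c := by
    filter_upwards [hc] with x hx
    rw [← hx, ← mul_apply_eq_comp, h.mul_inv, one_apply_eq_self]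
  obtain ⟨C, hC⟩ := h.exists_propagator_bound
  let z : ℤ → V := fun k => U (k * T) c
  have hz : MemLp z p Measure.count := by
    refine ⟨AEStronglyMeasurable.of_discrete, ?_⟩
    -- The value at the left end of a cell is controlled by W at almost every point of the cell, so
    -- membership in L^p passes to the sampled sequence.
    have h1 : ∀ᵐ x : ℝ, ‖z ⌊x / T⌋‖ ≤ C * ‖W x‖ := by
      filter_upwards [hWc] with x hx
      have h2 : z ⌊x / T⌋ = (U (⌊x / T⌋ * T) * Θ x) (W x) := by
        rw [hx, ← mul_apply_eq_comp, mul_assoc, h.inv_mul, mul_one]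
      rw [h2]
      refine (U (⌊x / T⌋ * T) * Θ x).le_of_opNorm_le (hC _ _ ?_) _
      have hx' : x ∈ cell T ⌊x / T⌋ := rfl
      rw [cell_eq_Ico hT] at hx'
      rw [abs_le]
      constructor <;> linarith [hx'.1, hx'.2]
    have h3 := eLpNorm_le_mul_eLpNorm_of_ae_le_mul h1 p
    rw [eLpNorm_comp_floor_div hT] at h3
    have h4 := h3.trans_lt (ENNReal.mul_lt_top ENNReal.ofReal_lt_top hWp.2)
    refine (ENNReal.mul_lt_top_iff.1 h4).elim (fun h => h.2) fun h => ?_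
    rcases h with h | h
    · exfalso
      simp [ENNReal.rpow_eq_zero_iff, hT.not_ge] at h
    · rw [h]; exact ENNReal.zero_lt_top
  have hzk : ∀ k, hz.toLp z k = z k := Measure.ae_count_iff.1 hz.coeFn_toLp
  have hu := isUnit_shift_sub_pointwise (p := p) hP hPM hroot
  have hz0 : hz.toLp z = 0 := by
    -- The samples satisfy z(k + 1) = U(T) z(k), so they lie in the kernel of the invertible
    -- operator S - U(T).
    have hinj : (shift V p 1 - pointwise V p (U T)) (hz.toLp z) = 0 := by
      rw [sub_apply, sub_eq_zero]
      refine coeFn_count_ext fun k => ?_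
      rw [shift_apply, pointwise_apply, hzk, hzk]
      have h1 := h.propagator_add_int_mul T 0 k
      rw [h.inv_zero, mul_one, add_zero] at h1
      simp only [z]
      rw [← h1, ← mul_apply_eq_comp, mul_assoc, h.inv_mul, mul_one]
      push_cast
      ring_nf
    obtain ⟨b, hb⟩ := hu.exists_left_inv
    have := congrArg b hinj
    rwa [← mul_apply_eq_comp, hb, one_apply_eq_self, _root_.map_zero] at this
  have hc0 : c = 0 := by
    have h1 := hzk 0
    rw [hz0] at h1
    have h2 : (0 : Lp V p (Measure.count : Measure ℤ)) 0 = 0 :=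
      Measure.ae_count_iff.1 (Lp.coeFn_zero V p (Measure.count : Measure ℤ)) 0
    rw [h2] at h1
    simpa [z, h.map_zero] using h1.symm
  filter_upwards [hWc] with x hx
  rw [hx, hc0, _root_.map_zero]

end IsFloquetPair

end Floquet

/-- A two-sided recursion with invertible step is determined by its value at `0`. -/
theorem eq_of_recursion {V : Type*} {step : ℤ → V → V} (hstep : ∀ k, Function.Injective (step k))
    {r z : ℤ → V} (hr : ∀ k, r (k + 1) = step k (r k)) (hz : ∀ k, z (k + 1) = step k (z k))
    (h0 : r 0 = z 0) (k : ℤ) : r k = z k := by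
  induction k using Int.induction_on with
  | zero => exact h0
  | succ i ih => rw [hr, hz, ih]
  | pred i ih =>
    apply hstep (-(i : ℤ) - 1)
    rw [← hr, ← hz, sub_add_cancel, ih]

/-! ### The inhomogeneous system in L^p -/

namespace IsFloquetPair

variable {V : Type*} [NormedAddCommGroup V] [NormedSpace ℝ V] [NormedSpace ℂ V]
  [IsScalarTower ℝ ℂ V] [CompleteSpace V] {T : ℝ} {a U Θ : ℝ → V →L[ℂ] V} {p : ℝ≥0∞}

-- Within one cell the propagator is bounded by C, so the response is bounded by the L¹ mass of the
-- forcing there. The right end point is admitted because the accumulated forcing over a full period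
-- needs it.
omit [IsScalarTower ℝ ℂ V] [CompleteSpace V] in
theorem enorm_integral_propagator_le {C : NNReal} (hC : ∀ x y, |x - y| ≤ T → ‖U x * Θ y‖ ≤ C)
    (hT : 0 < T) (F : ℝ → V) {k : ℤ} {x : ℝ} (hx : x ∈ Set.Icc (k * T) ((k + 1) * T)) :
    ‖∫ y in (k * T)..x, (U x * Θ y) (F y)‖ₑ ≤ C * ∫⁻ y in cell T k, ‖F y‖ₑ := by
  rw [intervalIntegral.integral_of_le hx.1, integral_Ioc_eq_integral_Ioo]
  refine (enorm_integral_le_lintegral_enorm _).trans ?_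
  rw [← lintegral_const_mul' _ _ ENNReal.coe_ne_top]
  have hsub : Set.Ioo (k * T) x ⊆ cell T k := by
    rw [cell_eq_Ico hT]
    exact fun y hy => ⟨hy.1.le, hy.2.trans_le hx.2⟩
  refine le_trans ?_ (lintegral_mono_set hsub)
  refine setLIntegral_mono' measurableSet_Ioo fun y hy => ?_
  have h1 := (U x * Θ y).le_of_opNorm_le (hC x y ?_) (F y)
  · rw [← ofReal_norm, ← ofReal_norm]
    refine (ENNReal.ofReal_le_ofReal h1).trans (le_of_eq ?_)
    rw [ENNReal.ofReal_mul C.coe_nonneg, ENNReal.ofReal_coe_nnreal]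
  · rw [abs_le]
    constructor <;> linarith [hy.1, hy.2, hx.1, hx.2]

/-- In the absence of multipliers of modulus one, `W' = a W + F` can be solved in `L^p`, with a
bound. -/
theorem exists_solution_memLp [Fact (1 ≤ p)] (h : IsFloquetPair T a U Θ)
    {P : Polynomial ℂ} (hP : P.Monic) (hPM : Polynomial.aeval (U T) P = 0)
    (hroot : ∀ μ, P.eval μ = 0 → ‖μ‖ ≠ 1) :
    ∃ C : NNReal, ∀ F : ℝ → V, MemLp F p volume → ∃ W : ℝ → V,
      HasWeakDeriv W (fun x => a x (W x) + F x) ∧ eLpNorm W p volume ≤ C * eLpNorm F p volume := by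
  have hp : 1 ≤ p := Fact.out
  have hT := h.period_pos
  obtain ⟨C, hC⟩ := h.exists_propagator_bound
  have hu := isUnit_shift_sub_pointwise (p := p) hP hPM hroot
  obtain ⟨b, hb⟩ := hu.exists_right_inv
  set κ : NNReal := T.toNNReal ^ (1 / p).toReal with hκ
  set σ : NNReal := T.toNNReal ^ (1 - 1 / p.toReal) with hσ
  have hκ' : (κ : ℝ≥0∞) = ENNReal.ofReal T ^ (1 / p).toReal := by
    rw [hκ, ENNReal.coe_rpow_of_nonneg _ ENNReal.toReal_nonneg]
    rfl
  -- The factor σ comes from Hölder on a cell, C from the propagator and κ from returning from ℓ^p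
  -- to L^p. The first summand bounds the values at the lattice points, the second the forcing
  -- inside a cell.
  refine ⟨C * (κ * (‖b‖₊ * (C * σ) + σ)), fun F hF => ?_⟩
  have hFl : LocallyIntegrable F := hF.locallyIntegrable hp
  let A : ℤ → ℝ≥0∞ := fun k => ∫⁻ x in cell T k, ‖F x‖ₑ
  have hA : eLpNorm A p Measure.count ≤ σ * eLpNorm F p volume :=
    eLpNorm_lintegral_cell_le hp hT hF.1
  -- The forcing of one cell, transported to the right end of that cell.
  let H : ℤ → V := fun k => ∫ y in (k * T)..((k + 1) * T), (U ((k + 1) * T) * Θ y) (F y)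
  have hHA : ∀ k, ‖H k‖ₑ ≤ C * ‖A k‖ₑ := fun k => by
    rw [enorm_eq_self]
    exact enorm_integral_propagator_le hC hT F
      ⟨by nlinarith, le_rfl⟩
  have hHn : eLpNorm H p Measure.count ≤ C * (σ * eLpNorm F p volume) := by
    refine (eLpNorm_le_nnreal_smul_eLpNorm_of_ae_le_mul'
      (Filter.Eventually.of_forall hHA) p).trans ?_
    rw [ENNReal.smul_def, smul_eq_mul]
    gcongr
  have hH : MemLp H p Measure.count := ⟨AEStronglyMeasurable.of_discrete, hHn.trans_lt
    (ENNReal.mul_lt_top ENNReal.coe_lt_top (ENNReal.mul_lt_top ENNReal.coe_lt_top hF.2))⟩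
  have hHk : ∀ k, hH.toLp H k = H k := Measure.ae_count_iff.1 hH.coeFn_toLp
  set z : Lp V p (Measure.count : Measure ℤ) := b (hH.toLp H) with hz
  have hzn : eLpNorm z p Measure.count ≤ ‖b‖₊ * (C * (σ * eLpNorm F p volume)) := by
    rw [← Lp.enorm_def]
    refine (b.le_opENorm _).trans ?_
    rw [Lp.enorm_toLp]
    exact mul_le_mul' le_rfl hHn
  have hzk : ∀ k, z (k + 1) = U T (z k) + H k := fun k => by
    have h1 : (shift V p 1 - pointwise V p (U T)) z = hH.toLp H := by
      rw [hz, ← mul_apply_eq_comp, hb, one_apply_eq_self]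
    rw [sub_apply, sub_eq_iff_eq_add] at h1
    have h2 : shift V p 1 z k = (hH.toLp H + pointwise V p (U T) z :
      Lp V p (Measure.count : Measure ℤ)) k := by rw [h1]
    rw [shift_apply, Measure.ae_count_iff.1 (Lp.coeFn_add _ _) k, Pi.add_apply, hHk,
      pointwise_apply, add_comm (H k)] at h2
    exact h2
  have hG : LocallyIntegrable fun x => Θ x (F x) :=
    locallyIntegrable_clm_apply hFl h.continuous_inv
  have hGi : ∀ s t, IntervalIntegrable (fun x => Θ x (F x)) volume s t := fun s t =>
    (hG.integrableOn_isCompact isCompact_uIcc).intervalIntegrable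
  -- Among all solutions, the initial value z(0) of the ℓ^p solution of (S - U(T))z = H singles out
  -- one whose lattice values are exactly z, and hence one in L^p.
  let Y : ℝ → V := fun x => z 0 + ∫ t in (0 : ℝ)..x, Θ t (F t)
  have hY : HasWeakDeriv Y fun x => Θ x (F x) := hasWeakDeriv_primitive hG (z 0)
  have hYst : ∀ s t, Y t = Y s + ∫ y in s..t, Θ y (F y) := fun s t => by
    simp only [Y]
    rw [add_assoc, intervalIntegral.integral_add_adjacent_intervals (hGi _ _) (hGi _ _)]
  let W : ℝ → V := fun x => U x (Y x)
  have hWst : ∀ s t, W t = (U t * Θ s) (W s) + ∫ y in s..t, (U t * Θ y) (F y) := fun s t => by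
    simp only [W]
    rw [hYst s t, map_add, ← mul_apply_eq_comp, mul_assoc, h.inv_mul, mul_one]
    congr 1
    exact ((U t).intervalIntegral_comp_comm (hGi s t)).symm
  have hWz : ∀ k : ℤ, W (k * T) = z k := by
    -- Agreement for negative k needs the recursion to run backwards, which the invertibility of
    -- U(T) permits.
    refine eq_of_recursion (r := fun k : ℤ => W (k * T)) (step := fun k v => U T v + H k)
      (fun k v w hvw => ?_) (fun k => ?_) hzk ?_
    · have h1 := congrArg (Θ T) (add_right_cancel hvw)
      rwa [← mul_apply_eq_comp, ← mul_apply_eq_comp, h.inv_mul, one_apply_eq_self,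
        one_apply_eq_self] at h1
    · have h1 := h.propagator_add_int_mul T 0 k
      rw [h.inv_zero, mul_one, add_zero] at h1
      have h2 : (k : ℝ) * T + T = (k + 1) * T := by ring
      rw [h2] at h1
      push_cast
      rw [hWst (k * T) ((k + 1) * T), h1]
    · simp [W, Y, h.map_zero]
  refine ⟨W, ?_, ?_⟩
  · have h1 := hY.clm_apply h.contDiff
    refine h1.congr (Filter.Eventually.of_forall fun x => rfl)
      (Filter.Eventually.of_forall fun x => ?_)
    simp only
    rw [(h.hasDerivAt x).deriv, mul_apply_eq_comp, ← mul_apply_eq_comp (U x), h.mul_inv,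
      one_apply_eq_self]
  · have hWx : ∀ x, ‖W x‖ₑ ≤ C * ‖‖z ⌊x / T⌋‖ₑ + A ⌊x / T⌋‖ₑ := by
      intro x
      have hx : x ∈ cell T ⌊x / T⌋ := rfl
      rw [cell_eq_Ico hT] at hx
      rw [hWst (⌊x / T⌋ * T) x, hWz, enorm_eq_self, mul_add]
      refine (enorm_add_le _ _).trans (add_le_add ?_ ?_)
      · have h1 := (U x * Θ (⌊x / T⌋ * T)).le_of_opNorm_le (hC x (⌊x / T⌋ * T) ?_) (z ⌊x / T⌋)
        · rw [← ofReal_norm, ← ofReal_norm]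
          refine (ENNReal.ofReal_le_ofReal h1).trans (le_of_eq ?_)
          rw [ENNReal.ofReal_mul C.coe_nonneg, ENNReal.ofReal_coe_nnreal]
        · rw [abs_le]
          constructor <;> linarith [hx.1, hx.2]
      · exact enorm_integral_propagator_le hC hT F ⟨hx.1, hx.2.le⟩
    refine (eLpNorm_le_nnreal_smul_eLpNorm_of_ae_le_mul'
      (g := fun x : ℝ => ‖z ⌊x / T⌋‖ₑ + A ⌊x / T⌋)
      (Filter.Eventually.of_forall hWx) p).trans ?_
    rw [ENNReal.smul_def, smul_eq_mul,
      eLpNorm_comp_floor_div hT p (fun k => ‖z k‖ₑ + A k), ← hκ']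
    have h1 : eLpNorm (fun k => ‖z k‖ₑ + A k) p Measure.count ≤
        ‖b‖₊ * (C * (σ * eLpNorm F p volume)) + σ * eLpNorm F p volume := by
      refine (eLpNorm_add_le (f := fun k => ‖z k‖ₑ) (g := A) AEStronglyMeasurable.of_discrete
        AEStronglyMeasurable.of_discrete hp).trans (add_le_add ?_ hA)
      rwa [eLpNorm_enorm]
    refine (mul_le_mul' le_rfl (mul_le_mul' le_rfl h1)).trans (le_of_eq ?_)
    push_cast
    ring

/-- Existence of Floquet pairs on spaces on which one-sided inverses are two-sided. -/
theorem exists_of_continuous (hinv : ∀ A B : V →L[ℂ] V, A * B = 1 → B * A = 1) (hT : 0 < T)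
    (ha : Continuous a) (hap : Function.Periodic a T) : ∃ U Θ, IsFloquetPair T a U Θ := by
  obtain ⟨K, hK⟩ := exists_norm_bound_of_periodic ha hap hT
  obtain ⟨U, Θ, hU, hΘ, hU0, hΘ0⟩ := exists_fundamental_pair ha hK
  have hl : ∀ x, Θ x * U x = 1 := fun x => by
    rw [adjoint_mul_solution_const hU hΘ, hU0, hΘ0, one_mul]
  exact ⟨U, Θ, hT, ha, hap, hU, hΘ, hU0, hl, fun x => hinv _ _ (hl x)⟩

-- ΘU' is constant, equal to 1, and Θ is the inverse of U.
omit [CompleteSpace V] in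
theorem eq_of_hasDerivAt (h : IsFloquetPair T a U Θ) {U' : ℝ → V →L[ℂ] V}
    (hU' : ∀ x, HasDerivAt U' (a x * U' x) x) (h0 : U' 0 = 1) : U' = U := by
  ext1 x
  have h2 := adjoint_mul_solution_const hU' h.hasDerivAt_inv x
  rw [h0, h.inv_zero, one_mul] at h2
  rw [← one_mul (U' x), ← h.mul_inv x, mul_assoc, h2, mul_one]

end IsFloquetPair

/-! ### Matrices as operators; the monodromy matrix -/

section MatrixFunctions

variable {ι : Type*} [Fintype ι] {X : Type*} [NormedAddCommGroup X] [NormedSpace ℝ X]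

/-- A linear map on the finite-dimensional space of entries is continuous, so entrywise derivatives
pass through it for any choice of norm on the target. -/
theorem hasDerivAt_linearMap_matrix (L : Matrix ι ι ℂ →ₗ[ℝ] X) {M : ℝ → Matrix ι ι ℂ}
    {M' : Matrix ι ι ℂ} {x : ℝ} (h : ∀ i j, HasDerivAt (fun y => M y i j) (M' i j) x) :
    HasDerivAt (fun y => L (M y)) (L M') x := by
  let L' : (ι → ι → ℂ) →L[ℝ] X :=
    LinearMap.toContinuousLinearMap (L ∘ₗ (Matrix.ofLinearEquiv ℝ).toLinearMap)
  have h1 : HasDerivAt (fun y => (fun i j => M y i j : ι → ι → ℂ)) (fun i j => M' i j) x :=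
    hasDerivAt_pi.2 fun i => hasDerivAt_pi.2 fun j => h i j
  exact L'.hasFDerivAt.comp_hasDerivAt x h1

theorem continuous_linearMap_matrix (L : Matrix ι ι ℂ →ₗ[ℝ] X) {M : ℝ → Matrix ι ι ℂ}
    (h : Continuous M) : Continuous fun y => L (M y) := by
  let L' : (ι → ι → ℂ) →L[ℝ] X :=
    LinearMap.toContinuousLinearMap (L ∘ₗ (Matrix.ofLinearEquiv ℝ).toLinearMap)
  exact L'.continuous.comp h

omit [Fintype ι] in
theorem hasDerivAt_matDeriv {M : ℝ → Matrix ι ι ℂ} (h : ∀ i j, ContDiff ℝ 1 fun x => M x i j)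
    (x : ℝ) (i j : ι) : HasDerivAt (fun y => M y i j) (matDeriv M x i j) x :=
  ((h i j).differentiable one_ne_zero x).hasDerivAt

omit [Fintype ι] in
theorem continuous_matDeriv {M : ℝ → Matrix ι ι ℂ} (h : ∀ i j, ContDiff ℝ 1 fun x => M x i j) :
    Continuous (matDeriv M) :=
  continuous_pi fun i => continuous_pi fun j => (h i j).continuous_deriv le_rfl

omit [Fintype ι] in
theorem periodic_matDeriv {M : ℝ → Matrix ι ι ℂ} {T : ℝ} (h : Function.Periodic M T) :
    Function.Periodic (matDeriv M) T := by
  intro x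
  ext i j
  simp only [matDeriv, Matrix.of_apply]
  rw [← deriv_comp_add_const]
  simp only [h _]

variable [DecidableEq ι]

/-- Matrices acting on `ℂ^ι`, as continuous linear maps. -/
def matOp (ι : Type*) [Fintype ι] [DecidableEq ι] :
    Matrix ι ι ℂ ≃ₐ[ℂ] ((ι → ℂ) →L[ℂ] (ι → ℂ)) :=
  Matrix.toLinAlgEquiv'.trans (Module.End.toContinuousLinearMap (ι → ℂ))

theorem matOp_apply (M : Matrix ι ι ℂ) (v : ι → ℂ) : matOp ι M v = M *ᵥ v := rfl

theorem hasDerivAt_matOp {M : ℝ → Matrix ι ι ℂ} {M' : Matrix ι ι ℂ} {x : ℝ}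
    (h : ∀ i j, HasDerivAt (fun y => M y i j) (M' i j) x) :
    HasDerivAt (fun y => matOp ι (M y)) (matOp ι M') x :=
  hasDerivAt_linearMap_matrix ((matOp ι).toLinearMap.restrictScalars ℝ) h

theorem continuous_matOp {M : ℝ → Matrix ι ι ℂ} (h : Continuous M) :
    Continuous fun y => matOp ι (M y) :=
  continuous_linearMap_matrix ((matOp ι).toLinearMap.restrictScalars ℝ) h

theorem matOp_symm_apply (L : (ι → ℂ) →L[ℂ] (ι → ℂ)) (i j : ι) :
    (matOp ι).symm L i j = L (Pi.single j 1) i := by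
  obtain ⟨M, rfl⟩ := (matOp ι).surjective L
  rw [AlgEquiv.symm_apply_apply, matOp_apply]
  simp

theorem hasDerivAt_matOp_symm {L : ℝ → (ι → ℂ) →L[ℂ] (ι → ℂ)} {L' : (ι → ℂ) →L[ℂ] (ι → ℂ)}
    {x : ℝ} (h : HasDerivAt L L' x) (i j : ι) :
    HasDerivAt (fun y => (matOp ι).symm (L y) i j) ((matOp ι).symm L' i j) x := by
  simp only [matOp_symm_apply]
  have h1 : HasDerivAt (fun y => L y (Pi.single j 1)) (L' (Pi.single j 1)) x := by
    have := ((ContinuousLinearMap.apply ℂ (ι → ℂ)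
      (Pi.single j 1 : ι → ℂ)).restrictScalars ℝ).hasFDerivAt.comp_hasDerivAt x h
    exact this
  exact hasDerivAt_pi.1 h1 i

theorem exists_isFloquetPair {𝔸 : ℝ → Matrix ι ι ℂ} (hc : Continuous 𝔸) {T : ℝ} (hT : 0 < T)
    (hp : Function.Periodic 𝔸 T) :
    ∃ Ψ Θ : ℝ → Matrix ι ι ℂ, IsFloquetPair T (fun x => matOp ι (𝔸 x)) (fun x => matOp ι (Ψ x))
      (fun x => matOp ι (Θ x)) := by
  obtain ⟨U, Θ, h⟩ := IsFloquetPair.exists_of_continuous (V := ι → ℂ) (fun A B hAB => by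
      obtain ⟨M, rfl⟩ := (matOp ι).surjective A
      obtain ⟨N, rfl⟩ := (matOp ι).surjective B
      rw [← map_mul, ← map_one (matOp ι)] at hAB ⊢
      rw [mul_eq_one_comm.1 ((matOp ι).injective hAB)]) hT (continuous_matOp hc)
    (fun x => by simp only [hp x])
  refine ⟨fun x => (matOp ι).symm (U x), fun x => (matOp ι).symm (Θ x), ?_⟩
  simpa only [AlgEquiv.apply_symm_apply] using h

theorem IsFloquetPair.isFundamentalSolution {𝔸 Ψ Θ : ℝ → Matrix ι ι ℂ} {T : ℝ}
    (h : IsFloquetPair T (fun x => matOp ι (𝔸 x)) (fun x => matOp ι (Ψ x))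
      (fun x => matOp ι (Θ x))) : IsFundamentalSolution 𝔸 Ψ := by
  refine ⟨fun x i j => ?_, (matOp ι).injective (by rw [h.map_zero, map_one])⟩
  simpa [← map_mul] using hasDerivAt_matOp_symm (h.hasDerivAt x) i j

theorem IsFloquetPair.eq_of_isFundamentalSolution {𝔸 Ψ Θ Ψ' : ℝ → Matrix ι ι ℂ} {T : ℝ}
    (h : IsFloquetPair T (fun x => matOp ι (𝔸 x)) (fun x => matOp ι (Ψ x))
      (fun x => matOp ι (Θ x))) (h' : IsFundamentalSolution 𝔸 Ψ') : Ψ' = Ψ := by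
  have h1 := h.eq_of_hasDerivAt (U' := fun y => matOp ι (Ψ' y)) (fun x => by
    rw [← map_mul]
    exact hasDerivAt_matOp (h'.1 x)) (by rw [h'.2, map_one])
  ext1 x
  exact (matOp ι).injective (congrFun h1 x)

theorem existsUnique_isFundamentalSolution {𝔸 : ℝ → Matrix ι ι ℂ} (hc : Continuous 𝔸) {T : ℝ}
    (hT : 0 < T) (hp : Function.Periodic 𝔸 T) : ∃! Ψ, IsFundamentalSolution 𝔸 Ψ := by
  obtain ⟨Ψ, Θ, h⟩ := exists_isFloquetPair hc hT hp
  exact ⟨Ψ, h.isFundamentalSolution, fun Ψ' h' => h.eq_of_isFundamentalSolution h'⟩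

/-- Uniqueness identifies the solution picked by choice in the definition with the one constructed
from the differential equation. -/
theorem isFloquetPair_fundamentalSolution {𝔸 : ℝ → Matrix ι ι ℂ} (hc : Continuous 𝔸) {T : ℝ}
    (hT : 0 < T) (hp : Function.Periodic 𝔸 T) :
    ∃ Θ : ℝ → Matrix ι ι ℂ, IsFloquetPair T (fun x => matOp ι (𝔸 x))
      (fun x => matOp ι (fundamentalSolution 𝔸 x)) (fun x => matOp ι (Θ x)) := by
  obtain ⟨Ψ, Θ, h⟩ := exists_isFloquetPair hc hT hp
  have hex : ∃ Ψ, IsFundamentalSolution 𝔸 Ψ := ⟨Ψ, h.isFundamentalSolution⟩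
  have h1 : fundamentalSolution 𝔸 = Ψ := by
    rw [fundamentalSolution, dif_pos hex]
    exact h.eq_of_isFundamentalSolution hex.choose_spec
  exact ⟨Θ, h1 ▸ h⟩

/-- Cayley–Hamilton: the characteristic polynomial of the monodromy matrix serves as the
annihilating polynomial in the shift argument. -/
theorem aeval_matOp_charpoly (M : Matrix ι ι ℂ) : Polynomial.aeval (matOp ι M) M.charpoly = 0 := by
  have := Polynomial.aeval_algHom_apply (matOp ι).toAlgHom M M.charpoly
  rw [Matrix.aeval_self_charpoly, map_zero] at this
  exact this

theorem charpoly_eval_eq_zero_iff (M : Matrix ι ι ℂ) (μ : ℂ) :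
    M.charpoly.eval μ = 0 ↔ (M - μ • (1 : Matrix ι ι ℂ)).det = 0 := by
  rw [Matrix.eval_charpoly, ← neg_sub, Matrix.det_neg]
  simp [Matrix.smul_one_eq_diagonal]

end MatrixFunctions

/-! ### A resolvent criterion in terms of the graph -/

section Resolvent

variable {X : Type*} [NormedAddCommGroup X] [NormedSpace ℂ X]

/-- Injectivity makes the chosen solution unique, and uniqueness makes it linear in g; the estimate
makes it bounded. -/
theorem mem_resolventSet_of_graph {L : X →ₗ.[ℂ] X} {z : ℂ}
    (hinj : ∀ v, (v, z • v) ∈ L.graph → v = 0) {C : ℝ}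
    (hsurj : ∀ g, ∃ v, (v, z • v + g) ∈ L.graph ∧ ‖v‖ ≤ C * ‖g‖) : z ∈ resolventSet L := by
  choose R hR hRC using hsurj
  have huniq : ∀ {v w g}, (v, z • v + g) ∈ L.graph → (w, z • w + g) ∈ L.graph → v = w := by
    intro v w g hv hw
    rw [← sub_eq_zero]
    refine hinj _ ?_
    have := L.graph.sub_mem hv hw
    rwa [Prod.mk_sub_mk, add_sub_add_right_eq_sub, ← smul_sub] at this
  let R₀ : X →ₗ[ℂ] X :=
    { toFun := R
      map_add' := fun g h => by
        refine huniq (hR _) ?_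
        have := L.graph.add_mem (hR g) (hR h)
        rwa [Prod.mk_add_mk, add_add_add_comm, ← smul_add] at this
      map_smul' := fun c g => by
        refine huniq (hR _) ?_
        have := L.graph.smul_mem c (hR g)
        rwa [Prod.smul_mk, smul_add, smul_comm c z] at this }
  refine ⟨R₀.mkContinuous C hRC, fun g => ?_, fun v => ?_⟩
  · obtain ⟨y, hy1, hy2⟩ := (LinearPMap.mem_graph_iff L).1 (hR g)
    simp only at hy1 hy2
    have hmem : R g ∈ L.domain := hy1 ▸ y.2
    refine ⟨hmem, ?_⟩
    have hy : y = ⟨R g, hmem⟩ := Subtype.ext hy1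
    change L ⟨R g, hmem⟩ - z • R g = g
    rw [← hy, hy2, add_sub_cancel_left]
  · change R _ = v
    refine huniq (hR _) ?_
    rw [add_sub_cancel]
    exact L.mem_graph v

end Resolvent

section LpMultiplier

theorem memLp_clm_apply {E F : Type*} [NormedAddCommGroup E] [NormedSpace ℂ E]
    [NormedAddCommGroup F] [NormedSpace ℂ F] {p : ℝ≥0∞} {a : ℝ → E →L[ℂ] F} (ha : Continuous a)
    {C : ℝ} (hC : ∀ x, ‖a x‖ ≤ C) {f : ℝ → E} (hf : MemLp f p volume) :
    MemLp (fun x => a x (f x)) p volume :=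
  hf.of_le_mul (isBoundedBilinearMap_apply.continuous.comp_aestronglyMeasurable
    (ha.aestronglyMeasurable.prodMk hf.1))
    (Filter.Eventually.of_forall fun x => (a x).le_of_opNorm_le (hC x) _)

end LpMultiplier

/-! ### The phase space of pairs (w, w') -/

section PhaseSpace

variable {n : ℕ}

/-- The first component of a vector `(w, w')` of the phase space. -/
def fstE (n : ℕ) : (Fin n ⊕ Fin n → ℂ) →L[ℂ] EuclideanSpace ℂ (Fin n) :=
  LinearMap.toContinuousLinearMap
    { toFun := fun W => WithLp.toLp 2 fun i => W (Sum.inl i)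
      map_add' := fun _ _ => rfl
      map_smul' := fun _ _ => rfl }

/-- The second component of a vector `(w, w')` of the phase space. -/
def sndE (n : ℕ) : (Fin n ⊕ Fin n → ℂ) →L[ℂ] EuclideanSpace ℂ (Fin n) :=
  LinearMap.toContinuousLinearMap
    { toFun := fun W => WithLp.toLp 2 fun i => W (Sum.inr i)
      map_add' := fun _ _ => rfl
      map_smul' := fun _ _ => rfl }

/-- The embedding `w ↦ (w, 0)`. -/
def inlE (n : ℕ) : EuclideanSpace ℂ (Fin n) →L[ℂ] (Fin n ⊕ Fin n → ℂ) :=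
  LinearMap.toContinuousLinearMap
    { toFun := fun w => Sum.elim w.ofLp 0
      map_add' := fun _ _ => by ext (i | i) <;> simp
      map_smul' := fun _ _ => by ext (i | i) <;> simp }

/-- The embedding `w ↦ (0, w)`. -/
def inrE (n : ℕ) : EuclideanSpace ℂ (Fin n) →L[ℂ] (Fin n ⊕ Fin n → ℂ) :=
  LinearMap.toContinuousLinearMap
    { toFun := fun w => Sum.elim 0 w.ofLp
      map_add' := fun _ _ => by ext (i | i) <;> simp
      map_smul' := fun _ _ => by ext (i | i) <;> simp }

@[simp] theorem fstE_inlE (w : EuclideanSpace ℂ (Fin n)) : fstE n (inlE n w) = w := rfl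
@[simp] theorem sndE_inlE (w : EuclideanSpace ℂ (Fin n)) : sndE n (inlE n w) = 0 := rfl
@[simp] theorem fstE_inrE (w : EuclideanSpace ℂ (Fin n)) : fstE n (inrE n w) = 0 := rfl
@[simp] theorem sndE_inrE (w : EuclideanSpace ℂ (Fin n)) : sndE n (inrE n w) = w := rfl

theorem eq_zero_of_fstE_sndE {W : Fin n ⊕ Fin n → ℂ} (h1 : fstE n W = 0) (h2 : sndE n W = 0) :
    W = 0 := by
  ext (i | i)
  · exact congrArg (fun w : EuclideanSpace ℂ (Fin n) => w.ofLp i) h1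
  · exact congrArg (fun w : EuclideanSpace ℂ (Fin n) => w.ofLp i) h2

theorem act_add (M : Matrix (Fin n) (Fin n) ℂ) (v w : EuclideanSpace ℂ (Fin n)) :
    act M (v + w) = act M v + act M w :=
  map_add (Matrix.toEuclideanCLM (𝕜 := ℂ) M) v w

theorem add_act (M N : Matrix (Fin n) (Fin n) ℂ) (v : EuclideanSpace ℂ (Fin n)) :
    act (M + N) v = act M v + act N v := by
  simp only [act, map_add]; rfl

theorem sub_act (M N : Matrix (Fin n) (Fin n) ℂ) (v : EuclideanSpace ℂ (Fin n)) :
    act (M - N) v = act M v - act N v := by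
  simp only [act, map_sub]; rfl

theorem act_mul (M N : Matrix (Fin n) (Fin n) ℂ) (v : EuclideanSpace ℂ (Fin n)) :
    act (M * N) v = act M (act N v) := by
  simp only [act, map_mul]; rfl

theorem one_act (v : EuclideanSpace ℂ (Fin n)) :
    act (1 : Matrix (Fin n) (Fin n) ℂ) v = v := by
  simp only [act, map_one]; rfl

theorem smul_one_act (z : ℂ) (v : EuclideanSpace ℂ (Fin n)) :
    act (z • (1 : Matrix (Fin n) (Fin n) ℂ)) v = z • v := by
  simp only [act, map_smul, map_one]; rfl

theorem matOp_systemMatrix (A B : ℝ → Matrix (Fin n) (Fin n) ℂ) (z : ℂ) (x : ℝ)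
    (W : Fin n ⊕ Fin n → ℂ) :
    matOp _ (systemMatrix A B z x) W = inlE n (sndE n W) + inrE n (act (B x)⁻¹
      (z • fstE n W + act (matDeriv A x) (fstE n W) +
        (act (A x) (sndE n W) - act (matDeriv B x) (sndE n W)))) := by
  have hW : W = Sum.elim (fstE n W).ofLp (sndE n W).ofLp := by
    ext (i | i) <;> rfl
  have h1 : act (B x)⁻¹ (z • fstE n W + act (matDeriv A x) (fstE n W) +
      (act (A x) (sndE n W) - act (matDeriv B x) (sndE n W))) =
      act ((B x)⁻¹ * (z • (1 : Matrix (Fin n) (Fin n) ℂ) + matDeriv A x)) (fstE n W) +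
      act ((B x)⁻¹ * (A x - matDeriv B x)) (sndE n W) := by
    rw [act_mul, act_mul, ← act_add, add_act, sub_act, smul_one_act]
  rw [h1, matOp_apply, systemMatrix]
  conv_lhs => rw [hW]
  rw [Matrix.fromBlocks_mulVec]
  ext (i | i)
  · simp [inlE, inrE]
  · change _ = (0 : ℂ) + _
    rw [zero_add]
    rfl

end PhaseSpace

/-! ### Periodic `C¹` coefficients -/

section Coefficients

variable {n : ℕ} {T : ℝ}

/-- Matrix-valued functions which are of class `C¹` and `T`-periodic. -/
structure IsPeriodicC1 (M : ℝ → Matrix (Fin n) (Fin n) ℂ) (T : ℝ) : Prop where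
  contDiff : ∀ i j, ContDiff ℝ 1 fun x => M x i j
  periodic : Function.Periodic M T

/-- Matrices acting on `EuclideanSpace`, as a real-linear map. -/
def actL (n : ℕ) : Matrix (Fin n) (Fin n) ℂ →ₗ[ℝ]
    (EuclideanSpace ℂ (Fin n) →L[ℂ] EuclideanSpace ℂ (Fin n)) :=
  (AlgEquivClass.toAlgEquiv
    (Matrix.toEuclideanCLM (n := Fin n) (𝕜 := ℂ))).toLinearMap.restrictScalars ℝ

theorem actL_apply (M : Matrix (Fin n) (Fin n) ℂ) (v : EuclideanSpace ℂ (Fin n)) :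
    actL n M v = act M v := rfl

theorem IsPeriodicC1.continuous {M : ℝ → Matrix (Fin n) (Fin n) ℂ} (h : IsPeriodicC1 M T) :
    Continuous M :=
  continuous_pi fun i => continuous_pi fun j => (h.contDiff i j).continuous

theorem IsPeriodicC1.hasDerivAt_actL {M : ℝ → Matrix (Fin n) (Fin n) ℂ} (h : IsPeriodicC1 M T)
    (x : ℝ) : HasDerivAt (fun x => actL n (M x)) (actL n (matDeriv M x)) x :=
  hasDerivAt_linearMap_matrix (actL n) (hasDerivAt_matDeriv h.contDiff x)

theorem IsPeriodicC1.contDiff_actL {M : ℝ → Matrix (Fin n) (Fin n) ℂ} (h : IsPeriodicC1 M T) :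
    ContDiff ℝ 1 fun x => actL n (M x) := by
  rw [contDiff_one_iff_deriv, funext fun x => (h.hasDerivAt_actL x).deriv]
  exact ⟨fun x => (h.hasDerivAt_actL x).differentiableAt,
    continuous_linearMap_matrix _ (continuous_matDeriv h.contDiff)⟩

theorem IsPeriodicC1.continuous_inv {B : ℝ → Matrix (Fin n) (Fin n) ℂ} (hB : IsPeriodicC1 B T)
    (hBu : ∀ x, IsUnit (B x).det) : Continuous fun x => (B x)⁻¹ := by
  simp only [Matrix.inv_def, Ring.inverse_eq_inv']
  exact (hB.continuous.matrix_det.inv₀ fun x => (hBu x).ne_zero).smul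
    hB.continuous.matrix_adjugate

theorem continuous_systemMatrix {A B : ℝ → Matrix (Fin n) (Fin n) ℂ} (hA : IsPeriodicC1 A T)
    (hB : IsPeriodicC1 B T) (hBu : ∀ x, IsUnit (B x).det) (z : ℂ) :
    Continuous (systemMatrix A B z) :=
  Continuous.matrix_fromBlocks continuous_const continuous_const
    ((hB.continuous_inv hBu).matrix_mul
      (continuous_const.add (continuous_matDeriv hA.contDiff)))
    ((hB.continuous_inv hBu).matrix_mul
      (hA.continuous.sub (continuous_matDeriv hB.contDiff)))

theorem periodic_systemMatrix {A B : ℝ → Matrix (Fin n) (Fin n) ℂ} (hA : IsPeriodicC1 A T)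
    (hB : IsPeriodicC1 B T) (z : ℂ) : Function.Periodic (systemMatrix A B z) T := fun x => by
  rw [systemMatrix, systemMatrix, hA.periodic, hB.periodic, periodic_matDeriv hA.periodic,
    periodic_matDeriv hB.periodic]

theorem act_act_inv {M : Matrix (Fin n) (Fin n) ℂ} (h : IsUnit M.det)
    (v : EuclideanSpace ℂ (Fin n)) : act M (act M⁻¹ v) = v := by
  rw [← act_mul, Matrix.mul_nonsing_inv _ h, one_act]

theorem act_inv_act {M : Matrix (Fin n) (Fin n) ℂ} (h : IsUnit M.det)
    (v : EuclideanSpace ℂ (Fin n)) : act M⁻¹ (act M v) = v := by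
  rw [← act_mul, Matrix.nonsing_inv_mul _ h, one_act]

end Coefficients

/-! ### Equivalence of the operator equation with the first-order system -/

section Reduction

variable {n : ℕ} {A B : ℝ → Matrix (Fin n) (Fin n) ℂ} {T : ℝ} {p : ℝ≥0∞} {z : ℂ}

/-- Multiplying the second row of the system by B and applying the product rule recovers the
divergence form. Since the coefficients are bounded, W in L^p forces v' and v'' into L^p. -/
theorem opRel_of_hasWeakDeriv_system (hA : IsPeriodicC1 A T) (hB : IsPeriodicC1 B T)
    (hT : 0 < T) (hBu : ∀ x, IsUnit (B x).det) {W : ℝ → Fin n ⊕ Fin n → ℂ} {g : LpSpace n p}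
    (hW : HasWeakDeriv W fun x => matOp _ (systemMatrix A B z x) (W x) +
      inrE n (act (B x)⁻¹ (g x))) (hWp : MemLp W p volume) {v : LpSpace n p}
    (hv : v =ᵐ[volume] fun x => fstE n (W x)) : OpRel A B p v (z • v + g) := by
  have hbdd := exists_norm_bound_of_periodic
    (continuous_matOp (continuous_systemMatrix hA hB hBu z))
    (fun x => by rw [periodic_systemMatrix hA hB z x]) hT
  obtain ⟨K, hK⟩ := hbdd
  obtain ⟨K', hK'⟩ := exists_norm_bound_of_periodic
    (continuous_linearMap_matrix (actL n) (hB.continuous_inv hBu))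
    (fun x => by rw [hB.periodic x]) hT
  have hBg : MemLp (fun x => act (B x)⁻¹ (g x)) p volume :=
    memLp_clm_apply (continuous_linearMap_matrix (actL n) (hB.continuous_inv hBu)) hK'
      (Lp.memLp g)
  have hsndp : MemLp (fun x => sndE n (W x)) p volume := (sndE n).comp_memLp' hWp
  have h2p : MemLp (fun x => sndE n (matOp _ (systemMatrix A B z x) (W x) +
      inrE n (act (B x)⁻¹ (g x)))) p volume :=
    (sndE n).comp_memLp' ((memLp_clm_apply
      (continuous_matOp (continuous_systemMatrix hA hB hBu z)) hK hWp).add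
      ((inrE n).comp_memLp' hBg))
  have h1 := hW.clm_comp (fstE n)
  simp only [matOp_systemMatrix, map_add, fstE_inlE, fstE_inrE, add_zero] at h1
  have h2 := hW.clm_comp (sndE n)
  have h3 := (h2.clm_apply hB.contDiff_actL).sub (h1.clm_apply hA.contDiff_actL)
  refine ⟨hsndp.toLp _, h2p.toLp _, h1.congr hv.symm hsndp.coeFn_toLp.symm,
    h2.congr hsndp.coeFn_toLp.symm h2p.coeFn_toLp.symm, h3.congr ?_ ?_⟩
  · filter_upwards [hv, hsndp.coeFn_toLp] with x hx1 hx2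
    rw [hx1, hx2]
    rfl
  · filter_upwards [hv, Lp.coeFn_add (z • v) g, Lp.coeFn_smul z v] with x hx1 hx2 hx3
    rw [hx2, Pi.add_apply, hx3, Pi.smul_apply, hx1, (hB.hasDerivAt_actL x).deriv,
      (hA.hasDerivAt_actL x).deriv, actL_apply, actL_apply, actL_apply, actL_apply,
      matOp_systemMatrix, map_add, map_add, sndE_inlE, sndE_inrE, sndE_inrE, zero_add]
    rw [act_add, act_act_inv (hBu x), act_act_inv (hBu x)]
    abel

/-- The product rule expands (Bv' - Av)', uniqueness of weak derivatives equates the result with zv,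
and B⁻¹ solves for v''. -/
theorem hasWeakDeriv_system_of_opRel (hA : IsPeriodicC1 A T) (hB : IsPeriodicC1 B T)
    (hBu : ∀ x, IsUnit (B x).det) {v : LpSpace n p} (h : OpRel A B p v (z • v)) :
    ∃ W : ℝ → Fin n ⊕ Fin n → ℂ, MemLp W p volume ∧ (v =ᵐ[volume] fun x => fstE n (W x)) ∧
      HasWeakDeriv W fun x => matOp _ (systemMatrix A B z x) (W x) := by
  obtain ⟨v₁, v₂, h1, h2, h3⟩ := h
  have h4 := (h2.clm_apply hB.contDiff_actL).sub (h1.clm_apply hA.contDiff_actL)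
  have h5 := h4.unique h3
  refine ⟨fun x => inlE n (v x) + inrE n (v₁ x), ((inlE n).comp_memLp' (Lp.memLp v)).add
    ((inrE n).comp_memLp' (Lp.memLp v₁)), Filter.Eventually.of_forall fun x => by simp, ?_⟩
  refine ((h1.clm_comp (inlE n)).add (h2.clm_comp (inrE n))).congr
    (Filter.Eventually.of_forall fun x => rfl) ?_
  filter_upwards [h5, Lp.coeFn_smul z v] with x hx1 hx2
  rw [(hB.hasDerivAt_actL x).deriv, (hA.hasDerivAt_actL x).deriv, actL_apply, actL_apply,
    actL_apply, actL_apply, hx2, Pi.smul_apply] at hx1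
  rw [matOp_systemMatrix]
  rw [map_add (fstE n), map_add (sndE n), sndE_inlE, sndE_inrE, fstE_inlE, fstE_inrE, add_zero,
    zero_add]
  congr 2
  rw [← act_inv_act (hBu x) (v₂ x), ← hx1]
  congr 1
  abel

/-- If no Floquet multiplier has modulus one, then `z` is in the `L^p` resolvent set. -/
theorem mem_resolventSet_of_no_multiplier [Fact (1 ≤ p)] (hA : IsPeriodicC1 A T)
    (hB : IsPeriodicC1 B T) (hT : 0 < T) (hBu : ∀ x, IsUnit (B x).det)
    (hM : ∀ γ : ℂ, (monodromy A B T z -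
      γ • (1 : Matrix (Fin n ⊕ Fin n) (Fin n ⊕ Fin n) ℂ)).det = 0 → ‖γ‖ ≠ 1) :
    z ∈ resolventSet (op A B p) := by
  obtain ⟨Θ, hF⟩ := isFloquetPair_fundamentalSolution (continuous_systemMatrix hA hB hBu z) hT
    (periodic_systemMatrix hA hB z)
  have hP : (monodromy A B T z).charpoly.Monic := Matrix.charpoly_monic _
  have hPM := aeval_matOp_charpoly (monodromy A B T z)
  have hroot : ∀ μ, (monodromy A B T z).charpoly.eval μ = 0 → ‖μ‖ ≠ 1 := fun μ hμ =>
    hM μ ((charpoly_eval_eq_zero_iff _ _).1 hμ)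
  obtain ⟨C, hC⟩ := hF.exists_solution_memLp (p := p) hP hPM hroot
  obtain ⟨K, hK⟩ := exists_norm_bound_of_periodic
    (continuous_linearMap_matrix (actL n) (hB.continuous_inv hBu))
    (fun x => by rw [hB.periodic x]) hT
  have hK0 : 0 ≤ K := (norm_nonneg _).trans (hK 0)
  refine mem_resolventSet_of_graph (C := ‖fstE n‖ * (C * (‖inrE n‖ * K))) (fun v hv => ?_)
    fun g => ?_
  · rw [mem_op_graph] at hv
    obtain ⟨W, hWp, hvW, hW⟩ := hasWeakDeriv_system_of_opRel hA hB hBu hv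
    have h0 := hF.ae_eq_zero_of_memLp hP hPM hroot hW hWp
    refine Lp.ext ?_
    filter_upwards [hvW, h0, Lp.coeFn_zero (EuclideanSpace ℂ (Fin n)) p (volume : Measure ℝ)]
      with x hx1 hx2 hx3
    rw [hx1, hx2, map_zero, hx3]
    rfl
  · have hFle : ∀ᵐ x, ‖inrE n (act (B x)⁻¹ (g x))‖ ≤ ‖inrE n‖ * K * ‖g x‖ :=
      Filter.Eventually.of_forall fun x => by
        rw [mul_assoc]
        exact (inrE n).le_opNorm_of_le ((actL n (B x)⁻¹).le_of_opNorm_le (hK x) _)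
    have hFp : MemLp (fun x => inrE n (act (B x)⁻¹ (g x))) p volume :=
      (inrE n).comp_memLp' (memLp_clm_apply
        (continuous_linearMap_matrix (actL n) (hB.continuous_inv hBu)) hK (Lp.memLp g))
    obtain ⟨W, hW, hWn⟩ := hC _ hFp
    have hWp : MemLp W p volume := ⟨hW.left.aestronglyMeasurable,
      hWn.trans_lt (ENNReal.mul_lt_top ENNReal.coe_lt_top hFp.2)⟩
    have hvp : MemLp (fun x => fstE n (W x)) p volume := (fstE n).comp_memLp' hWp
    refine ⟨hvp.toLp _, ?_, ?_⟩
    · rw [mem_op_graph]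
      exact opRel_of_hasWeakDeriv_system hA hB hT hBu hW hWp hvp.coeFn_toLp
    · rw [Lp.norm_toLp, Lp.norm_def, ← ENNReal.toReal_ofReal
        (by positivity : 0 ≤ ‖fstE n‖ * (C * (‖inrE n‖ * K))), ← ENNReal.toReal_mul]
      refine ENNReal.toReal_mono (ENNReal.mul_ne_top ENNReal.ofReal_ne_top (Lp.eLpNorm_ne_top g))
        ?_
      have e1 := eLpNorm_le_mul_eLpNorm_of_ae_le_mul (Filter.Eventually.of_forall fun x =>
        (fstE n).le_opNorm (W x)) (f := fun x => fstE n (W x)) (μ := volume) p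
      have e2 := eLpNorm_le_mul_eLpNorm_of_ae_le_mul hFle p
      refine e1.trans ?_
      rw [ENNReal.ofReal_mul (norm_nonneg _), ENNReal.ofReal_mul C.coe_nonneg,
        ENNReal.ofReal_coe_nnreal, mul_assoc, mul_assoc]
      exact mul_le_mul' le_rfl (hWn.trans (mul_le_mul' le_rfl e2))

end Reduction

/-! ### Cutoff functions and bounds for quasiperiodic functions -/

section Cutoff

/-- Slowly varying cutoff functions. -/
theorem exists_cutoff : ∃ K : ℝ, 0 ≤ K ∧ ∀ l : ℝ, 1 ≤ l → ∃ ψ ψ' ψ'' : ℝ → ℝ,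
    (∀ x, HasDerivAt ψ (ψ' x) x) ∧ (∀ x, HasDerivAt ψ' (ψ'' x) x) ∧ Continuous ψ'' ∧
    (∀ x, |x| ≤ l → ψ x = 1) ∧ (∀ x, 2 * l < |x| → ψ x = 0 ∧ ψ' x = 0 ∧ ψ'' x = 0) ∧
    ∀ x, |ψ' x| ≤ K / l ∧ |ψ'' x| ≤ K / l := by
  obtain ⟨χ, h0, h1, hcs, hone, hz⟩ : ∃ χ : ℝ → ℝ, ContDiff ℝ 2 χ ∧ ContDiff ℝ 1 (deriv χ) ∧
      HasCompactSupport χ ∧ (∀ x, |x| ≤ 1 → χ x = 1) ∧ ∀ x, 2 < |x| → x ∉ tsupport χ := by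
    let χ : ContDiffBump (0 : ℝ) := ⟨1, 2, one_pos, one_lt_two⟩
    refine ⟨χ, χ.contDiff, (χ.contDiff (n := 1 + 1)).deriv', χ.hasCompactSupport, fun x hx => ?_,
      fun x hx hmem => ?_⟩
    · refine χ.one_of_mem_closedBall ?_
      rwa [mem_closedBall_zero_iff, Real.norm_eq_abs]
    · rw [χ.tsupport_eq, mem_closedBall_zero_iff, Real.norm_eq_abs] at hmem
      exact absurd hmem (not_le.2 hx)
  have h2 : Continuous (deriv (deriv χ)) := h1.continuous_deriv le_rfl
  have hc1 : HasCompactSupport (deriv χ) := hcs.deriv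
  obtain ⟨K₁, hK₁⟩ := hc1.exists_bound_of_continuous h1.continuous
  obtain ⟨K₂, hK₂⟩ := hc1.deriv.exists_bound_of_continuous h2
  have hK₁0 : 0 ≤ K₁ := (norm_nonneg _).trans (hK₁ 0)
  have hz1 : ∀ x : ℝ, 2 < |x| → deriv χ x = 0 := fun x hx =>
    image_eq_zero_of_notMem_tsupport fun h => hz x hx (tsupport_deriv_subset h)
  have hz2 : ∀ x : ℝ, 2 < |x| → deriv (deriv χ) x = 0 := fun x hx =>
    image_eq_zero_of_notMem_tsupport fun h =>
      hz x hx (tsupport_deriv_subset (tsupport_deriv_subset h))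
  refine ⟨max K₁ K₂, hK₁0.trans (le_max_left _ _), fun l hl => ?_⟩
  have hl0 : 0 < l := one_pos.trans_le hl
  have hdiv : ∀ x : ℝ, HasDerivAt (fun x => x / l) l⁻¹ x := fun x => by
    simpa using (hasDerivAt_id x).div_const l
  refine ⟨fun x => χ (x / l), fun x => deriv χ (x / l) * l⁻¹,
    fun x => deriv (deriv χ) (x / l) * l⁻¹ * l⁻¹, fun x => ?_, fun x => ?_, ?_, fun x hx => ?_,
    fun x hx => ?_, fun x => ⟨?_, ?_⟩⟩
  · exact ((h0.differentiable two_ne_zero (x / l)).hasDerivAt).comp x (hdiv x)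
  · exact (((h1.differentiable one_ne_zero (x / l)).hasDerivAt).comp x (hdiv x)).mul_const _
  · exact ((h2.comp (continuous_id.div_const l)).mul continuous_const).mul continuous_const
  · refine hone _ ?_
    rw [abs_div, abs_of_pos hl0]
    exact (div_le_one hl0).2 hx
  · have hx' : 2 < |x / l| := by
      rwa [abs_div, abs_of_pos hl0, lt_div_iff₀ hl0]
    simp only
    rw [image_eq_zero_of_notMem_tsupport (hz _ hx'), hz1 _ hx', hz2 _ hx']
    simp
  · rw [abs_mul, abs_inv, abs_of_pos hl0, div_eq_mul_inv]
    exact mul_le_mul_of_nonneg_right ((hK₁ _).trans (le_max_left _ _)) (by positivity)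
  · rw [abs_mul, abs_mul, abs_inv, abs_of_pos hl0, div_eq_mul_inv]
    -- The second derivative scales like l⁻²; one factor l⁻¹ ≤ 1 is discarded.
    refine mul_le_of_le_one_right (by positivity) (inv_le_one_of_one_le₀ hl) |>.trans ?_
    exact mul_le_mul_of_nonneg_right ((hK₂ _).trans (le_max_right _ _)) (by positivity)

theorem memLp_of_eq_zero_of_lt_abs {E : Type*} [NormedAddCommGroup E] {f : ℝ → E}
    (hf : Continuous f) {r : ℝ} (h0 : ∀ x, r < |x| → f x = 0) (p : ℝ≥0∞) : MemLp f p volume :=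
  hf.memLp_of_hasCompactSupport (HasCompactSupport.intro (isCompact_Icc (a := -r) (b := r))
    fun x hx => h0 x (by
      by_contra h
      exact hx (abs_le.1 (not_lt.1 h))))

theorem exists_norm_bound_of_quasiperiodic {X : Type*} [NormedAddCommGroup X] [NormedSpace ℂ X]
    {f : ℝ → X} {T : ℝ} {γ : ℂ} (hγ : ‖γ‖ = 1) (hf : Continuous f) (hT : 0 < T)
    (hp : ∀ x, f (x + T) = γ • f x) : ∃ C, ∀ x, ‖f x‖ ≤ C := by
  obtain ⟨C, hC⟩ := exists_norm_bound_of_periodic hf.norm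
    (fun x => by rw [hp, norm_smul, hγ, one_mul]) hT
  exact ⟨C, fun x => by simpa using hC x⟩

end Cutoff

/-! ### Bloch solutions and their truncations -/

section Bloch

variable {n : ℕ} {A B : ℝ → Matrix (Fin n) (Fin n) ℂ} {T : ℝ} {p : ℝ≥0∞} {z γ : ℂ}

/-- A Floquet multiplier yields a nontrivial quasiperiodic solution of the system, written for
the components `w`, `w'`. -/
theorem exists_bloch_solution (hA : IsPeriodicC1 A T)
    (hB : IsPeriodicC1 B T) (hT : 0 < T) (hBu : ∀ x, IsUnit (B x).det)
    (hγ : (monodromy A B T z - γ • (1 : Matrix (Fin n ⊕ Fin n) (Fin n ⊕ Fin n) ℂ)).det = 0) :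
    ∃ W : ℝ → Fin n ⊕ Fin n → ℂ,
      (∀ x, HasDerivAt W (matOp _ (systemMatrix A B z x) (W x)) x) ∧
      (∀ x, W (x + T) = γ • W x) ∧ ∃ x ∈ Set.Icc 0 T, fstE n (W x) ≠ 0 := by
  obtain ⟨Θ, hF⟩ := isFloquetPair_fundamentalSolution (continuous_systemMatrix hA hB hBu z) hT
    (periodic_systemMatrix hA hB z)
  obtain ⟨c, hc0, hc⟩ := Matrix.exists_mulVec_eq_zero_iff.2 hγ
  rw [Matrix.sub_mulVec, Matrix.smul_mulVec, Matrix.one_mulVec, sub_eq_zero] at hc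
  set W : ℝ → Fin n ⊕ Fin n → ℂ := fun x =>
    matOp _ (fundamentalSolution (systemMatrix A B z) x) c with hW
  have hd : ∀ x, HasDerivAt W (matOp _ (systemMatrix A B z x) (W x)) x := fun x =>
    ((ContinuousLinearMap.apply ℂ (Fin n ⊕ Fin n → ℂ) c).restrictScalars
      ℝ).hasFDerivAt.comp_hasDerivAt x (hF.hasDerivAt x)
  have hq : ∀ x, W (x + T) = γ • W x := fun x => by
    simp only [hW]
    rw [hF.map_add_period, mul_apply_eq_comp, matOp_apply (fundamentalSolution _ T)]
    change matOp _ _ (monodromy A B T z *ᵥ c) = _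
    rw [hc, map_smul]
  refine ⟨W, hd, hq, ?_⟩
  -- If w vanished on one period it would vanish everywhere by quasiperiodicity, hence so would w',
  -- and then c = W(0) = 0.
  by_contra! hcon
  have hzero : ∀ x, fstE n (W x) = 0 := fun x => by
    have hq' : Function.Periodic (fun x => fstE n (W x) = 0) T := fun x => by
      simp only [hq, map_smul, smul_eq_zero, eq_iff_iff]
      -- The multiplier is nonzero because the monodromy matrix is invertible.
      refine or_iff_right fun hγ0 => hc0 ?_
      have h1 := (hF.inv_mul T)
      have h2 : matOp _ (fundamentalSolution (systemMatrix A B z) T) c = 0 := by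
        rw [matOp_apply]
        change monodromy A B T z *ᵥ c = 0
        rw [hc, hγ0, zero_smul]
      have h3 := congrArg (fun L : (Fin n ⊕ Fin n → ℂ) →L[ℂ] (Fin n ⊕ Fin n → ℂ) => L c) h1
      simp only [mul_apply_eq_comp, h2, map_zero, one_apply_eq_self] at h3
      exact h3.symm
    obtain ⟨t, ht, hte⟩ := hq'.exists_mem_Ico₀ hT x
    exact hte.mpr (hcon t ⟨ht.1, ht.2.le⟩)
  have hzero' : ∀ x, sndE n (W x) = 0 := fun x => by
    have h1 : HasDerivAt (fun x => fstE n (W x)) (fstE n (matOp _ (systemMatrix A B z x) (W x))) x :=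
      ((fstE n).restrictScalars ℝ).hasFDerivAt.comp_hasDerivAt x (hd x)
    rw [matOp_systemMatrix, map_add, fstE_inlE, fstE_inrE, add_zero] at h1
    simp only [hzero] at h1
    exact h1.unique (hasDerivAt_const x 0)
  have hW0 := eq_zero_of_fstE_sndE (hzero 0) (hzero' 0)
  simp only [hW, hF.map_zero, one_apply_eq_self] at hW0
  exact hc0 hW0

theorem continuous_of_solution {W : ℝ → Fin n ⊕ Fin n → ℂ}
    (hd : ∀ x, HasDerivAt W (matOp _ (systemMatrix A B z x) (W x)) x) : Continuous W :=
  continuous_iff_continuousAt.2 fun x => (hd x).continuousAt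

/-- Floquet multipliers of modulus one give eigenvalues on `L^∞`. -/
theorem mem_eigenvalues_top_of_multiplier (hA : IsPeriodicC1 A T)
    (hB : IsPeriodicC1 B T) (hT : 0 < T) (hBu : ∀ x, IsUnit (B x).det) (hγ1 : ‖γ‖ = 1)
    (hγ : (monodromy A B T z - γ • (1 : Matrix (Fin n ⊕ Fin n) (Fin n ⊕ Fin n) ℂ)).det = 0) :
    z ∈ eigenvalues (op A B ∞) := by
  obtain ⟨W, hd, hq, x₀, -, hx₀⟩ := exists_bloch_solution hA hB hT hBu hγ
  have hWc := continuous_of_solution hd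
  obtain ⟨C, hC⟩ := exists_norm_bound_of_quasiperiodic hγ1 hWc hT hq
  have hWp : MemLp W ∞ volume := memLp_top_of_bound hWc.aestronglyMeasurable C
    (Filter.Eventually.of_forall hC)
  have hvp : MemLp (fun x => fstE n (W x)) ∞ volume := (fstE n).comp_memLp' hWp
  have hW : HasWeakDeriv W fun x => matOp _ (systemMatrix A B z x) (W x) :=
    hasWeakDeriv_of_hasDerivAt hd
      ((continuous_matOp (continuous_systemMatrix hA hB hBu z)).clm_apply hWc)
  have hrel : OpRel A B ∞ (hvp.toLp _) (z • hvp.toLp _ + 0) := by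
    refine opRel_of_hasWeakDeriv_system hA hB hT hBu (hW.congr Filter.EventuallyEq.rfl ?_) hWp
      hvp.coeFn_toLp
    filter_upwards [Lp.coeFn_zero (EuclideanSpace ℂ (Fin n)) ∞ (volume : Measure ℝ)] with x hx
    rw [hx, Pi.zero_apply, act, map_zero, map_zero, add_zero]
  rw [add_zero, ← mem_op_graph] at hrel
  obtain ⟨y, hy1, hy2⟩ := (LinearPMap.mem_graph_iff _).1 hrel
  simp only at hy1 hy2
  refine ⟨y, fun h0 => ?_, by rw [hy2, hy1]⟩
  rw [hy1] at h0
  have h1 : (fun x => fstE n (W x)) =ᵐ[volume] fun _ => 0 :=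
    hvp.coeFn_toLp.symm.trans (by rw [h0]; exact Lp.coeFn_zero _ _ _)
  have h2 := Continuous.ae_eq_iff_eq volume ((fstE n).continuous.comp hWc) continuous_const |>.1 h1
  exact hx₀ (congrFun h2 x₀)

/-- The commutator of the differential expression with a cutoff function. -/
theorem opRel_cutoff (hA : IsPeriodicC1 A T) (hB : IsPeriodicC1 B T)
    (hBu : ∀ x, IsUnit (B x).det) {W : ℝ → Fin n ⊕ Fin n → ℂ}
    (hd : ∀ x, HasDerivAt W (matOp _ (systemMatrix A B z x) (W x)) x)
    {ψ ψ' ψ'' : ℝ → ℝ} (hψ : ∀ x, HasDerivAt ψ (ψ' x) x) (hψ' : ∀ x, HasDerivAt ψ' (ψ'' x) x)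
    (hψc : Continuous ψ'') {r : ℝ} (h0 : ∀ x, r < |x| → ψ x = 0 ∧ ψ' x = 0 ∧ ψ'' x = 0)
    {v g : LpSpace n p} (hv : v =ᵐ[volume] fun x => ψ x • fstE n (W x))
    (hg : g =ᵐ[volume] fun x => ψ' x • (act (B x) (sndE n (W x)) - act (A x) (fstE n (W x)) +
      (act (matDeriv B x) (fstE n (W x)) + act (B x) (sndE n (W x)))) +
      ψ'' x • act (B x) (fstE n (W x))) : OpRel A B p v (z • v + g) := by
  have hWc := continuous_of_solution hd
  have hψcont : Continuous ψ := continuous_iff_continuousAt.2 fun x => (hψ x).continuousAt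
  have hψ'cont : Continuous ψ' := continuous_iff_continuousAt.2 fun x => (hψ' x).continuousAt
  have hWd : Continuous fun x => matOp _ (systemMatrix A B z x) (W x) :=
    (continuous_matOp (continuous_systemMatrix hA hB hBu z)).clm_apply hWc
  set w : ℝ → EuclideanSpace ℂ (Fin n) := fun x => fstE n (W x) with hw
  set w₁ : ℝ → EuclideanSpace ℂ (Fin n) := fun x => sndE n (W x) with hw₁
  set w₂ : ℝ → EuclideanSpace ℂ (Fin n) := fun x =>
    sndE n (matOp _ (systemMatrix A B z x) (W x)) with hw₂
  have hwc : Continuous w := (fstE n).continuous.comp hWc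
  have hw₁c : Continuous w₁ := (sndE n).continuous.comp hWc
  have hw₂c : Continuous w₂ := (sndE n).continuous.comp hWd
  have dw : ∀ x, HasDerivAt w (w₁ x) x := fun x => by
    have h1 : HasDerivAt w (fstE n (matOp _ (systemMatrix A B z x) (W x))) x :=
      ((fstE n).restrictScalars ℝ).hasFDerivAt.comp_hasDerivAt x (hd x)
    rwa [matOp_systemMatrix, map_add, fstE_inlE, fstE_inrE, add_zero] at h1
  have dw₁ : ∀ x, HasDerivAt w₁ (w₂ x) x := fun x =>
    ((sndE n).restrictScalars ℝ).hasFDerivAt.comp_hasDerivAt x (hd x)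
  have hw₂eq : ∀ x, act (B x) (w₂ x) = z • w x + act (matDeriv A x) (w x) +
      (act (A x) (w₁ x) - act (matDeriv B x) (w₁ x)) := fun x => by
    simp only [hw₂]
    rw [matOp_systemMatrix, map_add, sndE_inlE, sndE_inrE, zero_add, act_act_inv (hBu x)]
  have hv₁c : Continuous fun x => ψ x • w₁ x + ψ' x • w x :=
    (hψcont.smul hw₁c).add (hψ'cont.smul hwc)
  have hv₂c : Continuous fun x => (ψ x • w₂ x + ψ' x • w₁ x) + (ψ' x • w₁ x + ψ'' x • w x) :=
    ((hψcont.smul hw₂c).add (hψ'cont.smul hw₁c)).add ((hψ'cont.smul hw₁c).add (hψc.smul hwc))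
  have dv : ∀ x, HasDerivAt (fun x => ψ x • w x) (ψ x • w₁ x + ψ' x • w x) x := fun x =>
    (hψ x).smul (dw x)
  have dv₁ : ∀ x, HasDerivAt (fun x => ψ x • w₁ x + ψ' x • w x)
      ((ψ x • w₂ x + ψ' x • w₁ x) + (ψ' x • w₁ x + ψ'' x • w x)) x := fun x =>
    ((hψ x).smul (dw₁ x)).add ((hψ' x).smul (dw x))
  have hv₁p : MemLp (fun x => ψ x • w₁ x + ψ' x • w x) p volume :=
    memLp_of_eq_zero_of_lt_abs hv₁c (r := r) (fun x hx => by simp [h0 x hx]) p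
  have hv₂p : MemLp (fun x => (ψ x • w₂ x + ψ' x • w₁ x) + (ψ' x • w₁ x + ψ'' x • w x)) p
      volume := memLp_of_eq_zero_of_lt_abs hv₂c (r := r) (fun x hx => by simp [h0 x hx]) p
  have h1 := hasWeakDeriv_of_hasDerivAt dv hv₁c
  have h2 := hasWeakDeriv_of_hasDerivAt dv₁ hv₂c
  have h3 := (h2.clm_apply hB.contDiff_actL).sub (h1.clm_apply hA.contDiff_actL)
  refine ⟨hv₁p.toLp _, hv₂p.toLp _, h1.congr hv.symm hv₁p.coeFn_toLp.symm,
    h2.congr hv₁p.coeFn_toLp.symm hv₂p.coeFn_toLp.symm, h3.congr ?_ ?_⟩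
  · filter_upwards [hv, hv₁p.coeFn_toLp] with x hx1 hx2
    rw [hx1, hx2]
    rfl
  · filter_upwards [hv, hg, Lp.coeFn_add (z • v) g, Lp.coeFn_smul z v] with x hx1 hx2 hx3 hx4
    have hs : ∀ (M : Matrix (Fin n) (Fin n) ℂ) (t : ℝ) (u : EuclideanSpace ℂ (Fin n)),
        act M (t • u) = t • act M u := fun M t u =>
      ContinuousLinearMap.map_smul_of_tower (Matrix.toEuclideanCLM (𝕜 := ℂ) M) t u
    change v x = ψ x • w x at hx1
    change g x = ψ' x • (act (B x) (w₁ x) - act (A x) (w x) +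
      (act (matDeriv B x) (w x) + act (B x) (w₁ x))) + ψ'' x • act (B x) (w x) at hx2
    rw [hx3, Pi.add_apply, hx4, Pi.smul_apply, hx1, hx2, (hB.hasDerivAt_actL x).deriv,
      (hA.hasDerivAt_actL x).deriv]
    -- The terms with undifferentiated ψ combine to zψw by the equation for w; the others are g.
    simp only [actL_apply, act_add, hs, hw₂eq, smul_add, smul_sub, smul_comm z (ψ x)]
    abel

/-- Floquet multipliers of modulus one give points of the spectrum on every `L^p`. -/
theorem not_mem_resolventSet_of_multiplier [Fact (1 ≤ p)] (hA : IsPeriodicC1 A T)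
    (hB : IsPeriodicC1 B T) (hT : 0 < T) (hBu : ∀ x, IsUnit (B x).det) (hγ1 : ‖γ‖ = 1)
    (hγ : (monodromy A B T z - γ • (1 : Matrix (Fin n ⊕ Fin n) (Fin n ⊕ Fin n) ℂ)).det = 0) :
    z ∉ resolventSet (op A B p) := by
  rintro ⟨R, -, hR⟩
  have hp : 1 ≤ p := Fact.out
  obtain ⟨W, hd, hq, x₀, hx₀, hWx₀⟩ := exists_bloch_solution hA hB hT hBu hγ
  have hWc := continuous_of_solution hd
  obtain ⟨K, hK0, hcut⟩ := exists_cutoff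
  set w : ℝ → EuclideanSpace ℂ (Fin n) := fun x => fstE n (W x) with hw
  have hwc : Continuous w := (fstE n).continuous.comp hWc
  set q₁ : ℝ → EuclideanSpace ℂ (Fin n) := fun x =>
    act (B x) (sndE n (W x)) - act (A x) (fstE n (W x)) +
      (act (matDeriv B x) (fstE n (W x)) + act (B x) (sndE n (W x))) with hq₁
  set q₂ : ℝ → EuclideanSpace ℂ (Fin n) := fun x => act (B x) (fstE n (W x)) with hq₂
  have hBa : Continuous fun x => actL n (B x) := continuous_linearMap_matrix _ hB.continuous
  have hAa : Continuous fun x => actL n (A x) := continuous_linearMap_matrix _ hA.continuous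
  have hB'a : Continuous fun x => actL n (matDeriv B x) :=
    continuous_linearMap_matrix _ (continuous_matDeriv hB.contDiff)
  have hsc : Continuous fun x => sndE n (W x) := (sndE n).continuous.comp hWc
  have hq₂c : Continuous q₂ := hBa.clm_apply hwc
  have hq₁c : Continuous q₁ := ((hBa.clm_apply hsc).sub (hAa.clm_apply hwc)).add
    ((hB'a.clm_apply hwc).add (hBa.clm_apply hsc))
  obtain ⟨C₁, hC₁⟩ := exists_norm_bound_of_quasiperiodic hγ1 hq₁c hT fun x => by
    simp only [hq₁]
    rw [hA.periodic, hB.periodic, periodic_matDeriv hB.periodic, hq]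
    simp only [act, map_smul, smul_add, smul_sub]
  obtain ⟨C₂, hC₂⟩ := exists_norm_bound_of_quasiperiodic hγ1 hq₂c hT fun x => by
    simp only [hq₂]
    rw [hB.periodic, hq]
    simp only [act, map_smul]
  have hC₁0 : 0 ≤ C₁ := (norm_nonneg _).trans (hC₁ 0)
  have hC₂0 : 0 ≤ C₂ := (norm_nonneg _).trans (hC₂ 0)
  -- D / l bounds the commutator term uniformly: K / l for the derivatives of ψ, C₁ and C₂ for their
  -- quasiperiodic coefficients.
  set D : ℝ := K * (C₁ + C₂) with hD
  have hD0 : 0 ≤ D := by positivity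
  have hα : 0 ≤ 1 - 1 / p.toReal := by
    rcases eq_or_ne p ∞ with rfl | htop
    · simp
    · have h1 : 1 ≤ p.toReal := by
        have := ENNReal.toReal_mono htop hp
        simpa using this
      rw [sub_nonneg]
      exact div_le_one_of_le₀ h1 (by positivity)
  have hβ : 0 ≤ 1 / p.toReal := by positivity
  -- The bound does not depend on l: the powers l⁻¹, l^(1/p) and l^(1 - 1/p) cancel. The 4 is the
  -- length 4l of [-2l, 2l] divided by l.
  have main : ∀ l : ℝ, 1 ≤ l →
      ∫⁻ x in Set.Ioc 0 l, ‖w x‖ₑ ≤ ‖R‖ₑ * ENNReal.ofReal (D * 4) := by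
    intro l hl
    have hl0 : 0 < l := one_pos.trans_le hl
    obtain ⟨ψ, ψ', ψ'', hψ, hψ', hψ''c, hψ1, hψ0, hψb⟩ := hcut l hl
    have hψc : Continuous ψ := continuous_iff_continuousAt.2 fun x => (hψ x).continuousAt
    have hψ'c : Continuous ψ' := continuous_iff_continuousAt.2 fun x => (hψ' x).continuousAt
    have hvp : MemLp (fun x => ψ x • w x) p volume :=
      memLp_of_eq_zero_of_lt_abs (hψc.smul hwc) (r := 2 * l) (fun x hx => by simp [hψ0 x hx]) p
    have hgp : MemLp (fun x => ψ' x • q₁ x + ψ'' x • q₂ x) p volume :=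
      memLp_of_eq_zero_of_lt_abs ((hψ'c.smul hq₁c).add (hψ''c.smul hq₂c)) (r := 2 * l)
        (fun x hx => by simp [hψ0 x hx]) p
    have hrel := opRel_cutoff hA hB hBu hd hψ hψ' hψ''c hψ0 hvp.coeFn_toLp hgp.coeFn_toLp
    rw [← mem_op_graph] at hrel
    obtain ⟨y, hy1, hy2⟩ := (LinearPMap.mem_graph_iff _).1 hrel
    simp only at hy1 hy2
    have hRy := hR y
    rw [hy2, hy1, add_sub_cancel_left] at hRy
    have hvg : eLpNorm (fun x => ψ x • w x) p volume ≤
        ‖R‖ₑ * eLpNorm (fun x => ψ' x • q₁ x + ψ'' x • q₂ x) p volume := by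
      rw [← Lp.enorm_toLp hvp, ← hRy, ← Lp.enorm_toLp hgp]
      exact R.le_opENorm _
    have hgn : eLpNorm (fun x => ψ' x • q₁ x + ψ'' x • q₂ x) p volume ≤
        ENNReal.ofReal (D / l) * ENNReal.ofReal (l * 4) ^ (1 / p.toReal) := by
      have h1 : ∀ x, ‖ψ' x • q₁ x + ψ'' x • q₂ x‖ ≤
          ‖(Set.Icc (-(2 * l)) (2 * l)).indicator (fun _ => D / l) x‖ := by
        intro x
        by_cases hx : x ∈ Set.Icc (-(2 * l)) (2 * l)
        · rw [Set.indicator_of_mem hx, Real.norm_of_nonneg (by positivity)]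
          refine (norm_add_le _ _).trans ?_
          rw [norm_smul, norm_smul, Real.norm_eq_abs, Real.norm_eq_abs]
          have := hψb x
          calc |ψ' x| * ‖q₁ x‖ + |ψ'' x| * ‖q₂ x‖ ≤ K / l * C₁ + K / l * C₂ := by
                gcongr
                exacts [this.1, hC₁ x, this.2, hC₂ x]
            _ = D / l := by rw [hD]; ring
        · have hx' : 2 * l < |x| := by
            by_contra h
            exact hx (abs_le.1 (not_lt.1 h))
          simp [hψ0 x hx']
      refine (eLpNorm_mono h1).trans ((eLpNorm_indicator_const_le _ _).trans ?_)
      rw [Real.volume_Icc, Real.enorm_of_nonneg (by positivity)]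
      refine le_of_eq ?_
      congr 3
      ring
    have hlow : ∫⁻ x in Set.Ioc 0 l, ‖w x‖ₑ ≤
        eLpNorm (fun x => ψ x • w x) p volume * ENNReal.ofReal l ^ (1 - 1 / p.toReal) := by
      have h1 : ∫⁻ x in Set.Ioc 0 l, ‖w x‖ₑ =
          eLpNorm (fun x => ψ x • w x) 1 (volume.restrict (Set.Ioc 0 l)) := by
        rw [eLpNorm_one_eq_lintegral_enorm]
        refine setLIntegral_congr_fun measurableSet_Ioc fun x hx => ?_
        rw [hψ1 x (by rw [abs_of_pos hx.1]; exact hx.2), one_smul]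
      rw [h1]
      refine (eLpNorm_le_eLpNorm_mul_rpow_measure_univ hp
        (hψc.smul hwc).aestronglyMeasurable).trans ?_
      rw [Measure.restrict_apply_univ, Real.volume_Ioc, sub_zero, ENNReal.toReal_one, div_one]
      gcongr
      exact eLpNorm_restrict_le _ _ _ _
    have hpow : ENNReal.ofReal (l * 4) ^ (1 / p.toReal) *
        ENNReal.ofReal l ^ (1 - 1 / p.toReal) ≤ ENNReal.ofReal (l * 4) := by
      calc ENNReal.ofReal (l * 4) ^ (1 / p.toReal) * ENNReal.ofReal l ^ (1 - 1 / p.toReal)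
          ≤ ENNReal.ofReal (l * 4) ^ (1 / p.toReal) *
            ENNReal.ofReal (l * 4) ^ (1 - 1 / p.toReal) := by
            gcongr
            linarith
        _ = ENNReal.ofReal (l * 4) := by
            rw [← ENNReal.rpow_add_of_nonneg _ _ hβ hα, add_sub_cancel, ENNReal.rpow_one]
    calc ∫⁻ x in Set.Ioc 0 l, ‖w x‖ₑ
        ≤ ‖R‖ₑ * (ENNReal.ofReal (D / l) * ENNReal.ofReal (l * 4) ^ (1 / p.toReal)) *
          ENNReal.ofReal l ^ (1 - 1 / p.toReal) :=
          hlow.trans (mul_le_mul' (hvg.trans (mul_le_mul' le_rfl hgn)) le_rfl)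
      _ = ‖R‖ₑ * (ENNReal.ofReal (D / l) * (ENNReal.ofReal (l * 4) ^ (1 / p.toReal) *
          ENNReal.ofReal l ^ (1 - 1 / p.toReal))) := by ring
      _ ≤ ‖R‖ₑ * (ENNReal.ofReal (D / l) * ENNReal.ofReal (l * 4)) := by gcongr
      _ = ‖R‖ₑ * ENNReal.ofReal (D * 4) := by
          rw [← ENNReal.ofReal_mul (by positivity)]
          congr 2
          field_simp
  have hperiodic : Function.Periodic (fun x => ‖w x‖) T := fun x => by
    simp only [hw]
    rw [hq, map_smul, norm_smul, hγ1, one_mul]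
  have hI : 0 < ∫ x in (0 : ℝ)..T, ‖w x‖ :=
    intervalIntegral.integral_pos hT hwc.norm.continuousOn (fun x _ => norm_nonneg _)
      ⟨x₀, hx₀, norm_pos_iff.2 hWx₀⟩
  -- N periods are long enough for the uniform bound to apply with l = NT, and N times the integral
  -- over one period already exceeds that bound.
  obtain ⟨N, hN⟩ := exists_nat_gt
    (max (1 / T) (‖R‖ * (D * 4) / ∫ x in (0 : ℝ)..T, ‖w x‖))
  have hN1 : 1 ≤ N * T := by
    have := (le_max_left _ _).trans_lt hN
    rw [div_lt_iff₀ hT] at this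
    exact this.le
  have hN2 := (le_max_right _ _).trans_lt hN
  rw [div_lt_iff₀ hI] at hN2
  have hsum := hperiodic.intervalIntegral_add_zsmul_eq (N : ℤ) 0
    (fun t₁ t₂ => hwc.norm.intervalIntegrable _ _)
  have hm := main _ hN1
  rw [← ofReal_integral_norm_eq_lintegral_enorm
    ((hwc.integrableOn_Icc (a := 0) (b := N * T)).mono_set Set.Ioc_subset_Icc_self),
    ← ofReal_norm, ← ENNReal.ofReal_mul (norm_nonneg _),
    ENNReal.ofReal_le_ofReal_iff (by positivity),
    ← intervalIntegral.integral_of_le (by linarith)] at hm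
  simp only [zero_add, zsmul_eq_mul, Int.cast_natCast] at hsum
  rw [hsum] at hm
  exact absurd hm (not_le.2 hN2)

end Bloch

/-! ### Spectrum, multipliers and zeros of the Evans function -/

section Spectrum

variable {n : ℕ} {A B : ℝ → Matrix (Fin n) (Fin n) ℂ} {T : ℝ}

theorem eigenvalues_subset_spectrum {X : Type*} [NormedAddCommGroup X] [NormedSpace ℂ X]
    (L : X →ₗ.[ℂ] X) : eigenvalues L ⊆ spectrum L := by
  rintro z ⟨v, hv0, hv⟩ ⟨R, -, hR⟩
  have := hR v
  rw [hv, sub_self, map_zero] at this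
  exact hv0 this.symm

/-- The `L^p` spectrum is the set of `z` with a Floquet multiplier of modulus one. -/
theorem spectrum_eq_multipliers (hA : IsPeriodicC1 A T) (hB : IsPeriodicC1 B T) (hT : 0 < T)
    (hBu : ∀ x, IsUnit (B x).det) (p : ℝ≥0∞) [Fact (1 ≤ p)] :
    spectrum (op A B p) = {z : ℂ | ∃ γ : ℂ, ‖γ‖ = 1 ∧ (monodromy A B T z -
      γ • (1 : Matrix (Fin n ⊕ Fin n) (Fin n ⊕ Fin n) ℂ)).det = 0} := by
  ext z
  constructor
  · intro hz
    by_contra hcon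
    exact hz (mem_resolventSet_of_no_multiplier hA hB hT hBu fun γ hγ hγ1 => hcon ⟨γ, hγ1, hγ⟩)
  · rintro ⟨γ, hγ1, hγ⟩
    exact not_mem_resolventSet_of_multiplier hA hB hT hBu hγ1 hγ

/-- Eigenvalues lie in the L^∞ spectrum, which is already known to be the set of multipliers of
modulus one; each of these in turn produces a bounded Bloch eigenfunction. -/
theorem eigenvalues_eq_multipliers (hA : IsPeriodicC1 A T) (hB : IsPeriodicC1 B T) (hT : 0 < T)
    (hBu : ∀ x, IsUnit (B x).det) :
    eigenvalues (op A B ∞) = {z : ℂ | ∃ γ : ℂ, ‖γ‖ = 1 ∧ (monodromy A B T z -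
      γ • (1 : Matrix (Fin n ⊕ Fin n) (Fin n ⊕ Fin n) ℂ)).det = 0} := by
  refine Set.Subset.antisymm ?_ ?_
  · rw [← spectrum_eq_multipliers hA hB hT hBu ∞]
    exact eigenvalues_subset_spectrum _
  · rintro z ⟨γ, hγ1, hγ⟩
    exact mem_eigenvalues_top_of_multiplier hA hB hT hBu hγ1 hγ

theorem multipliers_eq_evans_zeros (hT : 0 < T) :
    {z : ℂ | ∃ γ : ℂ, ‖γ‖ = 1 ∧ (monodromy A B T z -
      γ • (1 : Matrix (Fin n ⊕ Fin n) (Fin n ⊕ Fin n) ℂ)).det = 0} =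
      {z : ℂ | ∃ k : ℝ, evans A B T k z = 0} := by
  ext z
  constructor
  · rintro ⟨γ, hγ1, hγ⟩
    -- On the unit circle γ = e^{i arg γ}, so k = arg γ / T.
    refine ⟨γ.arg / T, ?_⟩
    have h1 : Complex.exp (Complex.I * (γ.arg / T : ℝ) * T) = γ := by
      have h2 := Complex.norm_mul_exp_arg_mul_I γ
      rw [hγ1, Complex.ofReal_one, one_mul] at h2
      rw [← h2]
      congr 1
      have hT' : (T : ℂ) ≠ 0 := by exact_mod_cast hT.ne'
      rw [h2]
      push_cast
      field_simp
    rw [evans, h1, hγ]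
  · rintro ⟨k, hk⟩
    refine ⟨_, ?_, hk⟩
    have : Complex.I * k * T = ((k * T : ℝ) : ℂ) * Complex.I := by push_cast; ring
    rw [this, Complex.norm_exp_ofReal_mul_I]

end Spectrum

/-! ### Regularity and invertibility of the coefficients of the wave -/

section WaveCoefficients

variable {n : ℕ} {f : (Fin n → ℝ) → Fin n → ℝ} {B : (Fin n → ℝ) → Matrix (Fin n) (Fin n) ℝ}
  {ubar : ℝ → Fin n → ℝ} {T : ℝ}

theorem isPeriodicC1_coeffB (hB : ∀ i j, ContDiff ℝ 2 fun u => B u i j)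
    (hubar : ContDiff ℝ 2 ubar) (hper : Function.Periodic ubar T) :
    IsPeriodicC1 (coeffB B ubar) T where
  contDiff i j := Complex.ofRealCLM.contDiff.comp
    (((hB i j).comp hubar).of_le (by norm_num))
  periodic x := by rw [coeffB, coeffB, hper]

/-- The coefficient involves first derivatives only, of f, of B and of the profile; each of these is
of class `C²`, so `C¹` remains. -/
theorem isPeriodicC1_coeffA (hf : ContDiff ℝ 2 f) (hB : ∀ i j, ContDiff ℝ 2 fun u => B u i j)
    (hubar : ContDiff ℝ 2 ubar) (hper : Function.Periodic ubar T) (s : ℝ) :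
    IsPeriodicC1 (coeffA f B ubar s) T where
  contDiff i j := by
    have hu1 : ContDiff ℝ 1 ubar := hubar.of_le (by norm_num)
    have hdu : ContDiff ℝ 1 (deriv ubar) := (show ContDiff ℝ (1 + 1) ubar from hubar).deriv'
    have h1 : ContDiff ℝ 1 fun x => fderiv ℝ f (ubar x) (Pi.single j 1) i :=
      contDiff_pi.1 (((hf.fderiv_right (m := 1) (by norm_num)).comp hu1).clm_apply
        contDiff_const) i
    have h2 : ContDiff ℝ 1 fun x => ∑ k, fderiv ℝ (fun u => B u i k) (ubar x) (Pi.single j 1) *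
        deriv ubar x k :=
      ContDiff.sum fun k _ => ((((hB i k).fderiv_right (m := 1) (by norm_num)).comp
        hu1).clm_apply contDiff_const).mul (contDiff_pi.1 hdu k)
    have h3 := Complex.ofRealCLM.contDiff.comp
      ((h1.sub (contDiff_const (c := (s • (1 : Matrix (Fin n) (Fin n) ℝ)) i j))).sub h2)
    convert h3 using 1
    ext x
    simp [coeffA, LinearMap.toMatrix'_apply]
  periodic x := by
    have hd : deriv ubar (x + T) = deriv ubar x := by
      rw [← deriv_comp_add_const]
      simp only [hper _]
    rw [coeffA, coeffA, hper, hd]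

/-- A singular matrix would have the eigenvalue 0, whose real part is not positive. -/
theorem isUnit_det_coeffB
    (hpar : ∀ x, ∀ μ ∈ _root_.spectrum ℂ ((B (ubar x)).map Complex.ofReal), 0 < μ.re) (x : ℝ) :
    IsUnit (coeffB B ubar x).det := by
  rw [← Matrix.isUnit_iff_isUnit_det]
  by_contra h
  exact lt_irrefl _ (hpar x 0 ((spectrum.zero_mem_iff ℂ).2 h))

end WaveCoefficients

end PeriodicWave

end

theorem proposition3p1 {n : ℕ}
    (f : (Fin n → ℝ) → Fin n → ℝ) (B : (Fin n → ℝ) → Matrix (Fin n) (Fin n) ℝ)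
    (ubar : ℝ → Fin n → ℝ) (s T : ℝ)
    (hf : ContDiff ℝ 2 f)
    (hB : ∀ i j, ContDiff ℝ 2 (fun u => B u i j))
    (hT : 0 < T)
    (hubar : ContDiff ℝ 2 ubar)
    (hper : Function.Periodic ubar T)
    (hwave : ∀ x i, deriv (fun y => (B (ubar y) *ᵥ deriv ubar y) i) x =
      deriv (fun y => f (ubar y) i) x - s * deriv ubar x i)
    (hpar : ∀ x, ∀ μ ∈ _root_.spectrum ℂ ((B (ubar x)).map Complex.ofReal), 0 < μ.re) :
    -- the fundamental solution, hence the monodromy matrix, is well defined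
    (∀ z : ℂ, ∃! Ψ, PeriodicWave.IsFundamentalSolution
      (PeriodicWave.systemMatrix (PeriodicWave.coeffA f B ubar s)
        (PeriodicWave.coeffB B ubar) z) Ψ) ∧
    -- for every `p`, the `L^p` spectrum is the set of `L^∞` eigenvalues
    (∀ (p : ℝ≥0∞) [Fact (1 ≤ p)],
      PeriodicWave.spectrum (PeriodicWave.op (PeriodicWave.coeffA f B ubar s)
        (PeriodicWave.coeffB B ubar) p) =
      PeriodicWave.eigenvalues (PeriodicWave.op (PeriodicWave.coeffA f B ubar s)
        (PeriodicWave.coeffB B ubar) ∞)) ∧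
    -- the `L^∞` eigenvalues are the `z` for which `M(z)` has an eigenvalue of modulus one
    PeriodicWave.eigenvalues (PeriodicWave.op (PeriodicWave.coeffA f B ubar s)
        (PeriodicWave.coeffB B ubar) ∞) =
      {z : ℂ | ∃ γ : ℂ, ‖γ‖ = 1 ∧
        (PeriodicWave.monodromy (PeriodicWave.coeffA f B ubar s)
          (PeriodicWave.coeffB B ubar) T z -
          γ • (1 : Matrix (Fin n ⊕ Fin n) (Fin n ⊕ Fin n) ℂ)).det = 0} ∧
    -- for every `p`, the `L^p` spectrum is the projection of the zero set of `D`
    (∀ (p : ℝ≥0∞) [Fact (1 ≤ p)],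
      PeriodicWave.spectrum (PeriodicWave.op (PeriodicWave.coeffA f B ubar s)
        (PeriodicWave.coeffB B ubar) p) =
      {z : ℂ | ∃ k : ℝ, PeriodicWave.evans (PeriodicWave.coeffA f B ubar s)
        (PeriodicWave.coeffB B ubar) T k z = 0}) := by
  have hA := PeriodicWave.isPeriodicC1_coeffA hf hB hubar hper s
  have hBc := PeriodicWave.isPeriodicC1_coeffB hB hubar hper
  have hBu := PeriodicWave.isUnit_det_coeffB hpar
  refine ⟨fun z => PeriodicWave.existsUnique_isFundamentalSolution
    (PeriodicWave.continuous_systemMatrix hA hBc hBu z) hT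
    (PeriodicWave.periodic_systemMatrix hA hBc z), fun p _ => ?_,
    PeriodicWave.eigenvalues_eq_multipliers hA hBc hT hBu, fun p _ => ?_⟩
  · rw [PeriodicWave.spectrum_eq_multipliers hA hBc hT hBu p,
      PeriodicWave.eigenvalues_eq_multipliers hA hBc hT hBu]
  · rw [PeriodicWave.spectrum_eq_multipliers hA hBc hT hBu p,
      PeriodicWave.multipliers_eq_evans_zeros hT]
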